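/- Let $M\cong\mathbb Z^n$ be a lattice with dual lattice $N$, and let $P\subset M_{\mathbb R}$ be a full-dimensional simple lattice polytope, written as $P=\{m\in M_{\mathbb R} : \langle m,u_\rho\rangle+c_\rho\ge 0 \text{ for all } \rho\in\Sigma(1)\}$, where $\Sigma$ is the inner normal fan of $P$, $\Sigma(1)$ is its set of rays (one for each facet of $P$), $u_\rho\in N$ is the primitive generator of $\rho$, and $c_\rho\in\mathbb Z$. Let $X=X_\Sigma$ be the associated projective simplicial toric variety with torus $\mathbb T$, $D_\rho$ the invariant prime divisor of $\rho$, $F_\rho=[D_\rho]_{\mathbb T}\in H^2_{\mathbb T}(X;\mathbb Q)$ its equivariant fundamental class, and $D_P=\sum_\rho c_\rho D_\rho$. For $\sigma\in\Sigma(n)$ let $\sigma(1)$ be the set of its rays, $i_\sigma:\{x_\sigma\}\hookrightarrow X$ the inclusion of the corresponding fixed point, and $$Eu^{\mathbb T}_X(x_\sigma)=i_\sigma^*\Big(\mathrm{mult}(\sigma)\prod_{\rho\in\sigma(1)}F_\rho\Big),\qquad \mathrm{mult}(\sigma)=|G_\sigma|,\qquad G_\sigma=\Big\{(t_\rho)\in(\mathbb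 C^*)^{\sigma(1)} : \prod_{\rho\in\sigma(1)} u_\rho(t_\rho)=1\in\mathbb T\Big\}.$$ For $z\in N_{\mathbb C}=\mathrm{Hom}_{\mathbb R}(M_{\mathbb R},\mathbb C)$ let $\langle\,\cdot\,,z\rangle:H^*_{\mathbb T}(pt;\mathbb R)\to\mathbb C$ be the ring homomorphism with $\langle -c_1^{\mathbb T}(\mathbb C_{\chi^m}),z\rangle=\langle m,z\rangle$ for $m\in M$. For $h=(h_\rho)\in\mathbb R^{\Sigma(1)}$ put $P(h)=\{m\in M_{\mathbb R} : \langle m,u_\rho\rangle+c_\rho+h_\rho\ge 0\text{ for all }\rho\}$ and $[D_{P(h)}]=\sum_\rho(c_\rho+h_\rho)F_\rho\in H^2_{\mathbb T}(X;\mathbb R)$. Let $dm$ be the Lebesgue measure on $M_{\mathbb R}$ for which the unit cube of $M$ has volume $1$. Then there is an $\varepsilon>0$, depending only on $P$, such that for all $h$ with $|h_\rho|<\varepsilon$ for every $\rho$, and for all $z\in N_{\mathbb C}$ with $\langle i_\sigma^*F_\rho,z\rangle\ne0$ for all $\sigma\in\Sigma(n)$ and $\rho\in\sigma(1)$, the function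 $m\mapsto e^{\langle m,z\rangle}$ is integrable on $P(h)$ and $$\int_{P(h)}e^{\langle m,z\rangle}\,dm=\sum_{\sigma\in\Sigma(n)}\frac{e^{\langle i_\sigma^*[D_{P(h)}],z\rangle}}{\langle Eu^{\mathbb T}_X(x_\sigma),z\rangle}=\sum_{\sigma\in\Sigma(n)}\frac{e^{\langle i_\sigma^*c_1^{\mathbb T}(\mathcal O_X(D_P)),z\rangle}}{\langle Eu^{\mathbb T}_X(x_\sigma),z\rangle}\cdot e^{\sum_\rho h_\rho\langle i_\sigma^*F_\rho,z\rangle},$$ where moreover $\langle i_\sigma^*[D_{P(h)}],z\rangle=\langle i_\sigma^*c_1^{\mathbb T}(\mathcal O_X(D_P)),z\rangle+\sum_\rho h_\rho\langle i_\sigma^*F_\rho,z\rangle$ for every $\sigma\in\Sigma(n)$. -/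

import Mathlib

noncomputable section

namespace Toric

variable {n : ℕ} {ι : Type*}

/-! ### Lattices, polytopes and the inner normal fan

The lattice `M` of characters and the dual lattice `N` of one-parameter subgroups of the torus
`T = (ℂ*)ⁿ` are both `ℤⁿ`, with the canonical pairing; `M_ℝ = ℝⁿ`, `N_ℂ = ℂⁿ`. -/

/-- The canonical pairing `M × N → ℤ`. -/
def pairZ (m u : Fin n → ℤ) : ℤ := ∑ i, m i * u i

/-- The canonical pairing `M_ℝ × N → ℝ`. -/
def pairR (m : Fin n → ℝ) (u : Fin n → ℤ) : ℝ := ∑ i, m i * (u i : ℝ)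

/-- The canonical pairing `M_ℝ × N_ℂ → ℂ`. -/
def pairC (m : Fin n → ℝ) (z : Fin n → ℂ) : ℂ := ∑ i, (m i : ℂ) * z i

/-- The inclusion `ℤⁿ ⊆ ℝⁿ`. -/
def latticePoint (m : Fin n → ℤ) : Fin n → ℝ := fun i => (m i : ℝ)

/-- The set of all `m ∈ M_ℝ` with `⟨m, u_ρ⟩ + b_ρ ≥ 0` for all `ρ`. -/
def polyhedron (u : ι → Fin n → ℤ) (b : ι → ℝ) : Set (Fin n → ℝ) :=
  {m | ∀ ρ, 0 ≤ pairR m (u ρ) + b ρ}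

/-- A full-dimensional simple lattice polytope `P ⊆ M_ℝ`, given by its (unique) facet presentation
`P = {m | ⟨m, u_ρ⟩ + c_ρ ≥ 0 for all ρ}`: the index set `ι` is the set of facets of `P`, equivalently
the set `Σ(1)` of rays of the inner normal fan, and `u_ρ ∈ N` is the generator of the ray `ρ`, that
is the primitive inner normal vector of the facet. -/
structure SimpleLatticePolytope (n : ℕ) (ι : Type*) [Fintype ι] where
  /-- the ray generators `u_ρ` -/
  u : ι → Fin n → ℤ
  /-- the constants `c_ρ` -/
  c : ι → ℤ
  /-- `P` is a lattice polytope: the convex hull of finitely many points of `M` -/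
  lattice : ∃ V : Finset (Fin n → ℤ),
    polyhedron u (fun ρ => (c ρ : ℝ)) = convexHull ℝ (latticePoint '' (V : Set (Fin n → ℤ)))
  /-- `P` is full-dimensional -/
  full : (interior (polyhedron u (fun ρ => (c ρ : ℝ)))).Nonempty
  /-- the `u_ρ` are primitive vectors of `N` -/
  primitive : ∀ ρ, Finset.univ.gcd (u ρ) = 1
  /-- different indices belong to different facets -/
  injective : Function.Injective u
  /-- every inequality defines a facet: a nonempty face of dimension `n - 1` -/
  facet_nonempty : ∀ ρ,
    {m ∈ polyhedron u (fun ρ => (c ρ : ℝ)) | pairR m (u ρ) + c ρ = 0}.Nonempty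
  facet_dim : ∀ ρ, Module.finrank ℝ (vectorSpan ℝ
    {m ∈ polyhedron u (fun ρ => (c ρ : ℝ)) | pairR m (u ρ) + c ρ = 0}) + 1 = n
  /-- `P` is simple: every vertex lies on exactly `n` facets -/
  simple : ∀ v ∈ (polyhedron u (fun ρ => (c ρ : ℝ))).extremePoints ℝ,
    {ρ | pairR v (u ρ) + c ρ = 0}.ncard = n

variable [Fintype ι] (P : SimpleLatticePolytope n ι)

namespace SimpleLatticePolytope

/-- The polytope `P` as a subset of `M_ℝ`. -/
def carrier : Set (Fin n → ℝ) := polyhedron P.u (fun ρ => (P.c ρ : ℝ))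

/-- The dilation `P(h)`, defined by `⟨m, u_ρ⟩ + c_ρ + h_ρ ≥ 0` for all `ρ`. -/
def dilation (h : ι → ℝ) : Set (Fin n → ℝ) := polyhedron P.u (fun ρ => (P.c ρ : ℝ) + h ρ)

/-- The set `Σ(n)` of `n`-dimensional cones of the inner normal fan `Σ` of `P`. They are the normal
cones `σ_v` of the vertices `v` of `P`; a cone `σ` is recorded by its set of rays `σ(1) ⊆ Σ(1)`, and
the rays of `σ_v` are the inner normals of the facets through `v`. -/
def MaxCone : Type _ :=
  {s : Finset ι // ∃ v ∈ P.carrier.extremePoints ℝ, ∀ ρ, ρ ∈ s ↔ pairR v (P.u ρ) + P.c ρ = 0}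

instance : Finite P.MaxCone := by unfold MaxCone; infer_instance

instance : Fintype P.MaxCone := Fintype.ofFinite _

variable {P} in
/-- The set `σ(1)` of rays of `σ`. -/
def MaxCone.rays (σ : P.MaxCone) : Finset ι := σ.1

variable {P} in
/-- The cone `σ ⊆ N_ℝ`, generated by the `u_ρ`, `ρ ∈ σ(1)`. -/
def MaxCone.cone (σ : P.MaxCone) : Set (Fin n → ℝ) :=
  {x | ∃ a : ι → ℝ, (∀ ρ, 0 ≤ a ρ) ∧ (∀ ρ, ρ ∉ σ.rays → a ρ = 0) ∧
    x = ∑ ρ, a ρ • latticePoint (P.u ρ)}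

end SimpleLatticePolytope

/-! ### Torus, characters, equivariant line bundles on the toric variety

`X = X_Σ` is covered by the affine charts `U_σ = Spec ℂ[σ^∨ ∩ M]`, `σ ∈ Σ(n)`. -/

/-- The torus `T = (ℂ*)ⁿ`. -/
abbrev Torus (n : ℕ) : Type := Fin n → ℂˣ

/-- The character `χ^m` of the torus. -/
def chi (m : Fin n → ℤ) (t : Torus n) : ℂˣ := ∏ i, t i ^ m i

/-- `ℂ[M]`, the ring of regular functions on the torus. -/
abbrev CharRing (n : ℕ) : Type := AddMonoidAlgebra ℂ (Fin n → ℤ)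

/-- The action `(t · f)(p) = f(t⁻¹ p)` of the torus on `ℂ[M]`; thus `t · χ^m = χ^m(t)⁻¹ χ^m`. -/
def torusAct (t : Torus n) (f : CharRing n) : CharRing n :=
  .ofCoeff (Finsupp.onFinset f.coeff.support
    (fun m => ((chi m t)⁻¹ : ℂˣ) * f.coeff m)
    (fun m hm => by
      rw [Finsupp.mem_support_iff]
      exact right_ne_zero_of_mul hm))

variable {P}

/-- The semigroup `S_σ = σ^∨ ∩ M`. -/
def semigroup (σ : P.MaxCone) : Set (Fin n → ℤ) := {m | ∀ ρ ∈ σ.rays, 0 ≤ pairZ m (P.u ρ)}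

/-- The maximal ideal of the fixed point `x_σ` in the coordinate ring `ℂ[S_σ]` of `U_σ`: it is spanned
by the `χ^m`, `0 ≠ m ∈ S_σ`. -/
def fixedPointIdeal (σ : P.MaxCone) : Submodule ℂ (CharRing n) :=
  AddMonoidAlgebra.supported ℂ ℂ {m | m ∈ semigroup σ ∧ m ≠ 0}

/-- The sections over `U_σ` of the sheaf `O_X(D)` of a `T`-invariant divisor `D = ∑ a_ρ D_ρ`: rational
functions `f`, regular on the torus, with `ord_{D_ρ}(f) + a_ρ ≥ 0` for `ρ ∈ σ(1)`, where
`ord_{D_ρ}(χ^m) = ⟨m, u_ρ⟩`. -/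
def sections (D : ι → ℤ) (σ : P.MaxCone) : Submodule ℂ (CharRing n) :=
  AddMonoidAlgebra.supported ℂ ℂ {m | ∀ ρ ∈ σ.rays, 0 ≤ pairZ m (P.u ρ) + D ρ}

/-- The fibre at `x_σ` of `O_X(D)`: the sections over `U_σ` modulo the maximal ideal of `x_σ` times
the sections. -/
abbrev Fibre (D : ι → ℤ) (σ : P.MaxCone) : Type :=
  sections D σ ⧸ (fixedPointIdeal σ * sections D σ).submoduleOf (sections D σ)

/-- The fibre of `O_X(D)` at `x_σ` is the one-dimensional `T`-representation `ℂ_{χ^μ}`: the torus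
acts on it through the character `χ^μ`. -/
def IsFibreCharacter (D : ι → ℤ) (σ : P.MaxCone) (μ : Fin n → ℤ) : Prop :=
  Module.finrank ℂ (Fibre D σ) = 1 ∧
  ∀ t : Torus n, ∀ f ∈ sections D σ,
    torusAct t f - ((chi μ t : ℂˣ) : ℂ) • f ∈ fixedPointIdeal σ * sections D σ

variable (P) in
/-- `D` is a Cartier divisor: on every chart `U_σ` it is the divisor of a character `χ^{-m}`. -/
def IsCartier (D : ι → ℤ) : Prop :=
  ∀ σ : P.MaxCone, ∃ m : Fin n → ℤ, ∀ ρ ∈ σ.rays, pairZ m (P.u ρ) = -D ρ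


/-! ### Elementary facts -/

lemma pairR_latticePoint (m u : Fin n → ℤ) : pairR (latticePoint m) u = (pairZ m u : ℝ) := by
  simp [pairR, pairZ, latticePoint]

lemma pairR_add (x y : Fin n → ℝ) (u : Fin n → ℤ) : pairR (x + y) u = pairR x u + pairR y u := by
  simp [pairR, add_mul, Finset.sum_add_distrib]

lemma pairR_smul (a : ℝ) (x : Fin n → ℝ) (u : Fin n → ℤ) : pairR (a • x) u = a * pairR x u := by
  simp [pairR, Finset.mul_sum, mul_assoc]

lemma pairZ_add (x y : Fin n → ℤ) (u : Fin n → ℤ) : pairZ (x + y) u = pairZ x u + pairZ y u := by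
  simp [pairZ, add_mul, Finset.sum_add_distrib]

lemma pairZ_neg (x : Fin n → ℤ) (u : Fin n → ℤ) : pairZ (-x) u = -pairZ x u := by
  simp [pairZ]

lemma pairZ_smul (k : ℤ) (x : Fin n → ℤ) (u : Fin n → ℤ) : pairZ (k • x) u = k * pairZ x u := by
  simp [pairZ, Finset.mul_sum, mul_assoc]

/-- The rays of a cone `σ ∈ Σ(n)` span `N_ℝ`. -/
lemma eq_zero_of_pairR (σ : P.MaxCone) (x : Fin n → ℝ)
    (hx : ∀ ρ ∈ σ.rays, pairR x (P.u ρ) = 0) : x = 0 := by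
  obtain ⟨v, hv, hσ⟩ := σ.2
  have key : ∀ y : Fin n → ℝ, (∀ ρ ∈ σ.rays, pairR y (P.u ρ) = 0) →
      ∀ᶠ ε in nhds (0 : ℝ), v + ε • y ∈ P.carrier := by
    intro y hy
    have : ∀ ρ, ∀ᶠ ε in nhds (0 : ℝ), 0 ≤ pairR (v + ε • y) (P.u ρ) + P.c ρ := by
      intro ρ
      by_cases h : ρ ∈ σ.rays
      · refine Filter.Eventually.of_forall fun ε => ?_
        rw [pairR_add, pairR_smul, hy ρ h, mul_zero, add_zero]
        exact hv.1 ρ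
      · have h0 : 0 < pairR v (P.u ρ) + P.c ρ :=
          lt_of_le_of_ne (hv.1 ρ) (fun e => h ((hσ ρ).2 e.symm))
        have hc : ContinuousAt (fun ε : ℝ => pairR v (P.u ρ) + ε * pairR y (P.u ρ) + P.c ρ) 0 := by
          fun_prop
        have := hc.eventually (lt_mem_nhds (a := 0) (by simpa using h0))
        filter_upwards [this] with ε hε
        rw [pairR_add, pairR_smul]
        exact hε.le
    filter_upwards [Filter.eventually_all.2 this] with ε hε using hε
  have h1 := key x hx
  have h2 := key (-x) (fun ρ hρ => by
    have := pairR_smul (-1) x (P.u ρ)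
    simp only [neg_smul, one_smul] at this
    rw [this, hx ρ hρ, mul_zero])
  have h3 : ∀ᶠ ε in nhdsWithin (0 : ℝ) (Set.Ioi 0), 0 < ε := eventually_mem_nhdsWithin
  obtain ⟨ε, ⟨ha, hb⟩, hε⟩ :=
    (((h1.and h2).filter_mono nhdsWithin_le_nhds).and h3).exists
  have := hv.2 ha hb (by
    refine ⟨1 / 2, 1 / 2, by norm_num, by norm_num, by norm_num, ?_⟩
    ext i
    simp
    ring)
  have h4 : ε • x = 0 := by simpa using this
  exact (smul_eq_zero.1 h4).resolve_left hε.ne'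

lemma eq_zero_of_pairZ (σ : P.MaxCone) (m : Fin n → ℤ)
    (hm : ∀ ρ ∈ σ.rays, pairZ m (P.u ρ) = 0) : m = 0 := by
  have := eq_zero_of_pairR σ (latticePoint m) (fun ρ hρ => by
    rw [pairR_latticePoint, hm ρ hρ, Int.cast_zero])
  ext i
  have h := congrFun this i
  simpa [latticePoint] using h

lemma mem_fixedPointIdeal_mul {D : ι → ℤ} {σ : P.MaxCone} {m₀ : Fin n → ℤ}
    (h₀ : ∀ ρ ∈ σ.rays, pairZ m₀ (P.u ρ) = -D ρ) (f : CharRing n) :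
    f ∈ fixedPointIdeal σ * sections D σ ↔ f ∈ sections D σ ∧ f.coeff m₀ = 0 := by
  constructor
  · intro hf
    have hle : fixedPointIdeal σ * sections D σ ≤
        AddMonoidAlgebra.supported ℂ ℂ
          {m | (∀ ρ ∈ σ.rays, 0 ≤ pairZ m (P.u ρ) + D ρ) ∧ m ≠ m₀} := by
      rw [fixedPointIdeal, sections, AddMonoidAlgebra.supported_eq_span_single,
        AddMonoidAlgebra.supported_eq_span_single, Submodule.span_mul_span, Submodule.span_le]
      rintro _ ⟨_, ⟨a, ⟨ha, ha0⟩, rfl⟩, _, ⟨b, hb, rfl⟩, rfl⟩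
      simp only [AddMonoidAlgebra.single_mul_single, mul_one]
      rw [AddMonoidAlgebra.supported_eq_span_single]
      refine Submodule.subset_span ⟨a + b, ⟨fun ρ hρ => ?_, fun e => ha0 ?_⟩, rfl⟩
      · rw [pairZ_add]
        have := ha ρ hρ
        have := hb ρ hρ
        omega
      · refine eq_zero_of_pairZ σ a fun ρ hρ => ?_
        have h1 := ha ρ hρ
        have h2 := hb ρ hρ
        have h3 := h₀ ρ hρ
        rw [← e, pairZ_add] at h3
        omega
    have := hle hf
    rw [AddMonoidAlgebra.mem_supported'] at this
    refine ⟨?_, this m₀ (by simp)⟩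
    rw [sections, AddMonoidAlgebra.mem_supported']
    exact fun m hm => this m (fun h => hm h.1)
  · rintro ⟨hf, hf0⟩
    have hf' : f ∈ AddMonoidAlgebra.supported ℂ ℂ
          {m | (∀ ρ ∈ σ.rays, 0 ≤ pairZ m (P.u ρ) + D ρ) ∧ m ≠ m₀} := by
      rw [sections, AddMonoidAlgebra.mem_supported'] at hf
      rw [AddMonoidAlgebra.mem_supported']
      intro m hm
      by_cases e : m = m₀
      · rw [e, hf0]
      · exact hf m (fun h => hm ⟨h, e⟩)
    rw [AddMonoidAlgebra.supported_eq_span_single] at hf'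
    refine Submodule.span_le.2 ?_ hf'
    rintro _ ⟨m, ⟨hm, hne⟩, rfl⟩
    have e : (AddMonoidAlgebra.single m 1 : CharRing n) =
        AddMonoidAlgebra.single (m - m₀) 1 * AddMonoidAlgebra.single m₀ 1 := by
      simp [AddMonoidAlgebra.single_mul_single]
    rw [SetLike.mem_coe]
    simp only [e]
    refine Submodule.mul_mem_mul ?_ ?_
    · rw [fixedPointIdeal, AddMonoidAlgebra.supported_eq_span_single]
      refine Submodule.subset_span ⟨_, ⟨fun ρ hρ => ?_, sub_ne_zero.2 hne⟩, rfl⟩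
      rw [sub_eq_add_neg, pairZ_add, pairZ_neg, h₀ ρ hρ, neg_neg]
      exact hm ρ hρ
    · rw [sections, AddMonoidAlgebra.supported_eq_span_single]
      refine Submodule.subset_span ⟨_, fun ρ hρ => ?_, rfl⟩
      rw [h₀ ρ hρ]
      omega

lemma coeff_torusAct (t : Torus n) (f : CharRing n) (m : Fin n → ℤ) :
    (torusAct t f).coeff m = ((chi m t)⁻¹ : ℂˣ) * f.coeff m := rfl

lemma chi_neg (m : Fin n → ℤ) (t : Torus n) : chi (-m) t = (chi m t)⁻¹ := by
  simp [chi]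

lemma chi_injective {m m' : Fin n → ℤ} (h : ∀ t : Torus n, chi m t = chi m' t) : m = m' := by
  ext i
  have := h (Pi.mulSingle i (Units.mk0 (2 : ℂ) two_ne_zero))
  rw [chi, chi, Finset.prod_eq_single i, Finset.prod_eq_single i] at this
  · have h2 := congrArg (fun x : ℂˣ => ‖(x : ℂ)‖) this
    simp only [Pi.mulSingle_eq_same, Units.val_zpow_eq_zpow_val, Units.val_mk0, norm_zpow,
      Complex.norm_ofNat] at h2
    exact zpow_right_injective₀ (by norm_num) (by norm_num) h2
  all_goals simp +contextual [Pi.mulSingle_eq_of_ne]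

/-- If `D` is the divisor of `χ^{-m}` on `U_σ`, then `O_X(D)` is trivialized over `U_σ` by `χ^m`, and
the torus acts on the fibre at `x_σ` through `χ^{-m}`. -/
lemma isFibreCharacter_neg {D : ι → ℤ} {σ : P.MaxCone} {m : Fin n → ℤ}
    (h : ∀ ρ ∈ σ.rays, pairZ m (P.u ρ) = -D ρ) : IsFibreCharacter D σ (-m) := by
  constructor
  · let φ : sections D σ →ₗ[ℂ] ℂ :=
      { toFun := fun f => f.1.coeff m
        map_add' := fun _ _ => rfl
        map_smul' := fun _ _ => rfl }
    have hker : LinearMap.ker φ =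
        (fixedPointIdeal σ * sections D σ).submoduleOf (sections D σ) := by
      ext f
      rw [LinearMap.mem_ker, Submodule.submoduleOf, Submodule.mem_comap, Submodule.subtype_apply,
        mem_fixedPointIdeal_mul h]
      exact ⟨fun e => ⟨f.2, e⟩, fun e => e.2⟩
    have hsurj : Function.Surjective φ := by
      intro a
      refine ⟨⟨AddMonoidAlgebra.single m a, ?_⟩, ?_⟩
      · rw [sections, AddMonoidAlgebra.mem_supported']
        intro m' hm'
        rw [AddMonoidAlgebra.coeff_single, Finsupp.single_apply, if_neg]
        rintro rfl
        exact hm' fun ρ hρ => by rw [h ρ hρ]; omega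
      · change (AddMonoidAlgebra.single m a : CharRing n).coeff m = a
        simp
    have e := (Submodule.quotEquivOfEq _ _ hker).symm.trans (φ.quotKerEquivOfSurjective hsurj)
    exact e.finrank_eq.trans (Module.finrank_self ℂ)
  · intro t f hf
    rw [mem_fixedPointIdeal_mul h]
    constructor
    · rw [sections, AddMonoidAlgebra.mem_supported'] at hf ⊢
      intro m' hm'
      rw [AddMonoidAlgebra.coeff_sub, Finsupp.sub_apply, coeff_torusAct,
        AddMonoidAlgebra.coeff_smul, Finsupp.smul_apply, hf m' hm']
      simp
    · rw [AddMonoidAlgebra.coeff_sub, Finsupp.sub_apply, coeff_torusAct,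
        AddMonoidAlgebra.coeff_smul, Finsupp.smul_apply, chi_neg, smul_eq_mul, sub_self]

lemma IsFibreCharacter.unique {D : ι → ℤ} {σ : P.MaxCone} {μ μ' : Fin n → ℤ}
    (h : IsFibreCharacter D σ μ) (h' : IsFibreCharacter D σ μ') : μ = μ' := by
  refine chi_injective fun t => ?_
  by_contra hne
  have hne' : ((chi μ' t : ℂˣ) : ℂ) - (chi μ t : ℂˣ) ≠ 0 :=
    sub_ne_zero.2 fun e => hne (Units.ext e).symm
  have htop : (fixedPointIdeal σ * sections D σ).submoduleOf (sections D σ) = ⊤ := by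
    rw [eq_top_iff]
    rintro ⟨f, hf⟩ -
    rw [Submodule.submoduleOf, Submodule.mem_comap, Submodule.subtype_apply]
    have := Submodule.sub_mem _ (h.2 t f hf) (h'.2 t f hf)
    rw [sub_sub_sub_cancel_left, ← sub_smul] at this
    have h2 := Submodule.smul_mem _ (((chi μ' t : ℂˣ) : ℂ) - (chi μ t : ℂˣ))⁻¹ this
    rwa [smul_smul, inv_mul_cancel₀ hne', one_smul] at h2
  have h1 := h.1
  have : Subsingleton (Fibre D σ) := Submodule.Quotient.subsingleton_iff.2 htop
  rw [Module.finrank_zero_of_subsingleton] at h1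
  exact zero_ne_one h1

lemma card_rays (σ : P.MaxCone) : σ.rays.card = n := by
  obtain ⟨v, hv, hσ⟩ := σ.2
  have h := P.simple v hv
  have e : {ρ | pairR v (P.u ρ) + P.c ρ = 0} = (σ.rays : Set ι) := by
    ext ρ
    exact (hσ ρ).symm
  rwa [e, Set.ncard_coe_finset] at h

/-- On the simplicial toric variety `X` some multiple of `D` is principal on `U_σ`. -/
lemma exists_local_equation (D : ι → ℤ) (σ : P.MaxCone) :
    ∃ k : ℕ, 0 < k ∧ ∃ m : Fin n → ℤ, ∀ ρ ∈ σ.rays, pairZ m (P.u ρ) = -((k : ℤ) * D ρ) := by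
  let φ : (Fin n → ℚ) →ₗ[ℚ] (σ.rays → ℚ) :=
    { toFun := fun x ρ => ∑ i, x i * (P.u ρ i : ℚ)
      map_add' := fun x y => by
        ext ρ
        simp [add_mul, Finset.sum_add_distrib]
      map_smul' := fun a x => by
        ext ρ
        simp [Finset.mul_sum, mul_assoc] }
  have hinj : Function.Injective φ := by
    rw [injective_iff_map_eq_zero]
    intro x hx
    have := eq_zero_of_pairR σ (fun i => (x i : ℝ)) (fun ρ hρ => by
      have h := congrFun hx ⟨ρ, hρ⟩
      have h' : ∑ i, x i * (P.u ρ i : ℚ) = 0 := h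
      simpa [pairR] using congrArg (fun q : ℚ => (q : ℝ)) h')
    ext i
    have h := congrFun this i
    simpa using h
  have hsurj : Function.Surjective φ :=
    (LinearMap.injective_iff_surjective_of_finrank_eq_finrank (by simp [card_rays])).1 hinj
  obtain ⟨x, hx⟩ := hsurj (fun ρ => -(D ρ : ℚ))
  obtain ⟨b, hb⟩ := IsLocalization.exist_integer_multiples_of_finite (nonZeroDivisors ℤ) x
  choose y hy using hb
  have hb0 : (b : ℤ) ≠ 0 := nonZeroDivisors.coe_ne_zero b
  have hy' : ∀ i, (y i : ℚ) = (b : ℤ) * x i := fun i => by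
    simpa [Algebra.smul_def] using hy i
  have key : ∀ ρ ∈ σ.rays, pairZ y (P.u ρ) = -((b : ℤ) * D ρ) := by
    intro ρ hρ
    have h : ∑ i, x i * (P.u ρ i : ℚ) = -(D ρ : ℚ) := congrFun hx ⟨ρ, hρ⟩
    have : (pairZ y (P.u ρ) : ℚ) = -(((b : ℤ) : ℚ) * D ρ) := by
      rw [← mul_neg, ← h, Finset.mul_sum]
      simp [pairZ, hy', mul_assoc]
    exact_mod_cast this
  refine ⟨(b : ℤ).natAbs, Int.natAbs_pos.2 hb0, (b : ℤ).sign • y, fun ρ hρ => ?_⟩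
  rw [pairZ_smul, key ρ hρ, mul_neg, ← mul_assoc, Int.sign_mul_self_eq_natAbs]

variable (P) in
lemma exists_isCartier (D : ι → ℤ) : ∃ k : ℕ, 0 < k ∧ IsCartier P (fun ρ => (k : ℤ) * D ρ) := by
  choose k hk m hm using exists_local_equation (P := P) D
  classical
  refine ⟨∏ σ, k σ, Finset.prod_pos fun σ _ => hk σ, fun σ =>
    ⟨((∏ τ ∈ Finset.univ.erase σ, k τ : ℕ) : ℤ) • m σ, fun ρ hρ => ?_⟩⟩
  rw [pairZ_smul, hm σ ρ hρ, ← Finset.mul_prod_erase Finset.univ k (Finset.mem_univ σ)]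
  push_cast
  ring

/-! ### Equivariant cohomology

Coefficients are real, since the class of `D_{P(h)}` has real coefficients. -/

/-- `H_T^*(pt; ℝ) = ℝ[t_1, …, t_n]`. The generators are `t_i = -c_1^T(ℂ_{χ^{e_i}})`, for the standard
basis `e_i` of `M`; so this is the ring of polynomial functions on `N_ℝ`. -/
abbrev PtCohomology (n : ℕ) : Type := MvPolynomial (Fin n) ℝ

/-- `c(m) = c_1^T(ℂ_{χ^m}) ∈ H_T^2(pt)`, the first Chern class of the `T`-representation `ℂ_{χ^m}`,
regarded as an equivariant line bundle over a point. -/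
def chernPt (m : Fin n → ℤ) : PtCohomology n :=
  -∑ i, MvPolynomial.C (m i : ℝ) * MvPolynomial.X i

/-- The evaluation `⟨·, z⟩ : H_T^*(pt) → ℂ` at `z ∈ N_ℂ`: the ring homomorphism that extends
`⟨s(m), z⟩ = ⟨m, z⟩` for `s(m) = -c(m)`, `m ∈ M`. -/
def evalAt (z : Fin n → ℂ) : PtCohomology n →ₐ[ℝ] ℂ := MvPolynomial.aeval z

variable (P) in
/-- The equivariant cohomology ring `H_T^*(X; ℝ)` of the complete simplicial toric variety `X`, in its
description by restriction to the fixed points `x_σ`, `σ ∈ Σ(n)`: families `(f_σ)` of elements of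
`H_T^*(x_σ) = H_T^*(pt)` such that `f_σ` and `f_τ`, as polynomial functions on `N_ℝ`, agree on
`σ ∩ τ` (piecewise polynomial functions on the fan). It is an algebra over `H_T^*(pt)`. -/
def EquivCohomology :
    Subalgebra (PtCohomology n) (P.MaxCone → PtCohomology n) where
  carrier := {f | ∀ σ τ : P.MaxCone, ∀ x ∈ σ.cone ∩ τ.cone,
    MvPolynomial.eval x (f σ) = MvPolynomial.eval x (f τ)}
  mul_mem' := fun {f g} hf hg σ τ x hx => by
    simp only [Pi.mul_apply, map_mul, hf σ τ x hx, hg σ τ x hx]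
  add_mem' := fun {f g} hf hg σ τ x hx => by
    simp only [Pi.add_apply, map_add, hf σ τ x hx, hg σ τ x hx]
  algebraMap_mem' := fun _ _ _ _ _ => rfl

/-- The pullback `i_σ^* : H_T^*(X) → H_T^*(x_σ) = H_T^*(pt)` along the inclusion of `x_σ`. -/
def pullback (σ : P.MaxCone) : EquivCohomology P →ₐ[PtCohomology n] PtCohomology n :=
  (Pi.evalAlgHom (PtCohomology n) (fun _ : P.MaxCone => PtCohomology n) σ).comp
    (EquivCohomology P).val

lemma exists_isFibreCharacter {D : ι → ℤ} (hD : IsCartier P D) (σ : P.MaxCone) :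
    ∃ μ, IsFibreCharacter D σ μ := by
  obtain ⟨m, hm⟩ := hD σ
  exact ⟨-m, isFibreCharacter_neg hm⟩

/-- The character `μ` through which the torus acts on the fibre at `x_σ` of the line bundle
`O_X(D)`. -/
def fibreCharacter {D : ι → ℤ} (hD : IsCartier P D) (σ : P.MaxCone) : Fin n → ℤ :=
  (exists_isFibreCharacter hD σ).choose

lemma fibreCharacter_eq {D : ι → ℤ} (hD : IsCartier P D) (σ : P.MaxCone) {m : Fin n → ℤ}
    (hm : ∀ ρ ∈ σ.rays, pairZ m (P.u ρ) = -D ρ) : fibreCharacter hD σ = -m :=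
  (exists_isFibreCharacter hD σ).choose_spec.unique (isFibreCharacter_neg hm)

lemma eval_chernPt_neg (m : Fin n → ℤ) (x : Fin n → ℝ) :
    MvPolynomial.eval x (chernPt (-m)) = ∑ i, (m i : ℝ) * x i := by
  simp [chernPt]

lemma chernPt_fibreCharacter_mem {D : ι → ℤ} (hD : IsCartier P D) :
    (fun σ => chernPt (fibreCharacter hD σ)) ∈ EquivCohomology P := by
  intro σ τ x hx
  obtain ⟨m, hm⟩ := hD σ
  obtain ⟨m', hm'⟩ := hD τ
  simp only [fibreCharacter_eq hD σ hm, fibreCharacter_eq hD τ hm', eval_chernPt_neg]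
  obtain ⟨v, hv, hσ⟩ := σ.2
  obtain ⟨w, hw, hτ⟩ := τ.2
  obtain ⟨⟨a, ha, ha0, hxa⟩, ⟨b, hb, hb0, hxb⟩⟩ := hx
  have expand : ∀ (y : Fin n → ℝ) (a : ι → ℝ), x = ∑ ρ, a ρ • latticePoint (P.u ρ) →
      ∑ i, y i * x i = ∑ ρ, a ρ * pairR y (P.u ρ) := by
    intro y a h
    simp only [h, Finset.sum_apply, Pi.smul_apply, smul_eq_mul, pairR, latticePoint,
      Finset.mul_sum]
    rw [Finset.sum_comm]
    refine Finset.sum_congr rfl fun ρ _ => Finset.sum_congr rfl fun i _ => by ring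
  have vanish : ∀ (a : ι → ℝ) (σ : P.MaxCone) (v : Fin n → ℝ),
      (∀ ρ, ρ ∈ σ.rays ↔ pairR v (P.u ρ) + P.c ρ = 0) → (∀ ρ, ρ ∉ σ.rays → a ρ = 0) →
      ∑ ρ, a ρ * (pairR v (P.u ρ) + P.c ρ) = 0 := by
    intro a σ v h h0
    refine Finset.sum_eq_zero fun ρ _ => ?_
    by_cases hρ : ρ ∈ σ.rays
    · rw [(h ρ).1 hρ, mul_zero]
    · rw [h0 ρ hρ, zero_mul]
  have split : ∀ (a : ι → ℝ) (y : Fin n → ℝ), ∑ ρ, a ρ * (pairR y (P.u ρ) + P.c ρ) =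
      ∑ ρ, a ρ * pairR y (P.u ρ) + ∑ ρ, a ρ * P.c ρ := by
    intro a y
    simp [mul_add, Finset.sum_add_distrib]
  have h1 := vanish a σ v hσ ha0
  have h2 := vanish b τ w hτ hb0
  have h3 : ∀ ρ ∈ Finset.univ, 0 ≤ a ρ * (pairR w (P.u ρ) + P.c ρ) :=
    fun ρ _ => mul_nonneg (ha ρ) (hw.1 ρ)
  have h4 : ∀ ρ ∈ Finset.univ, 0 ≤ b ρ * (pairR v (P.u ρ) + P.c ρ) :=
    fun ρ _ => mul_nonneg (hb ρ) (hv.1 ρ)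
  have h5 := Finset.sum_nonneg h3
  have h6 := Finset.sum_nonneg h4
  rw [split] at h1 h2 h5 h6
  rw [← expand _ a hxa] at h1 h5
  rw [← expand _ b hxb] at h2 h6
  have h7 : ∑ ρ, a ρ * (pairR w (P.u ρ) + P.c ρ) = 0 := by
    rw [split, ← expand _ a hxa]
    linarith
  have h8 := (Finset.sum_eq_zero_iff_of_nonneg h3).1 h7
  have e : ∀ m : Fin n → ℤ, ∑ i, (m i : ℝ) * x i = ∑ ρ, a ρ * (pairZ m (P.u ρ) : ℝ) := by
    intro m
    have := expand (latticePoint m) a hxa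
    simp only [pairR_latticePoint] at this
    exact this
  rw [e, e]
  refine Finset.sum_congr rfl fun ρ _ => ?_
  rcases mul_eq_zero.1 (h8 ρ (Finset.mem_univ ρ)) with h | h
  · rw [h, zero_mul, zero_mul]
  · have hρτ : ρ ∈ τ.rays := (hτ ρ).2 h
    by_cases hρσ : ρ ∈ σ.rays
    · rw [hm ρ hρσ, hm' ρ hρτ]
    · rw [ha0 ρ hρσ, zero_mul, zero_mul]

/-- The equivariant first Chern class `c_1^T(O_X(D)) ∈ H_T^2(X)` of a `T`-invariant Cartier divisor
`D`. By naturality its pullback to `x_σ` is the first Chern class of the fibre of `O_X(D)` at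
`x_σ`. -/
def chernClass {D : ι → ℤ} (hD : IsCartier P D) : EquivCohomology P :=
  ⟨fun σ => chernPt (fibreCharacter hD σ), chernPt_fibreCharacter_mem hD⟩

open Classical in
variable (P) in
/-- The least positive `k` such that `k D` is Cartier. -/
def cartierIndex (D : ι → ℤ) : ℕ := Nat.find (exists_isCartier P D)

open Classical in
variable (P) in
lemma isCartier_cartierIndex (D : ι → ℤ) :
    IsCartier P (fun ρ => (cartierIndex P D : ℤ) * D ρ) :=
  (Nat.find_spec (exists_isCartier P D)).2

/-- The inclusion of the scalars `ℝ ⊆ H_T^0(X)`. -/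
def scalar (a : ℝ) : EquivCohomology P :=
  algebraMap (PtCohomology n) (EquivCohomology P) (MvPolynomial.C a)

variable (P) in
/-- The equivariant fundamental class `[D]_T ∈ H_T^2(X)` of a `T`-invariant divisor `D`: it is
`c_1^T(O_X(D))` when `D` is Cartier, and `c_1^T(O_X(k D)) / k` when `k D` is Cartier. -/
def divisorClass (D : ι → ℤ) : EquivCohomology P :=
  scalar ((cartierIndex P D : ℝ)⁻¹) * chernClass (isCartier_cartierIndex P D)

open Classical in
variable (P) in
/-- `F_ρ = [D_ρ]_T`. -/
def F (ρ : ι) : EquivCohomology P := divisorClass P (Pi.single ρ 1)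

variable (P) in
/-- `D_P = ∑ c_ρ D_ρ` is a Cartier divisor. -/
lemma isCartier_polytope : IsCartier P P.c := by
  intro σ
  obtain ⟨v, hv, hσ⟩ := σ.2
  obtain ⟨V, hV⟩ := P.lattice
  have hv' : v ∈ (convexHull ℝ (latticePoint '' (V : Set (Fin n → ℤ)))).extremePoints ℝ := by
    rw [← hV]
    exact hv
  obtain ⟨m, -, rfl⟩ := extremePoints_convexHull_subset hv'
  refine ⟨m, fun ρ hρ => ?_⟩
  have h := (hσ ρ).1 hρ
  rw [pairR_latticePoint] at h
  have h' : pairZ m (P.u ρ) + P.c ρ = 0 := by exact_mod_cast h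
  omega

variable (P) in
/-- The equivariant first Chern class `c_1^T(O_X(D_P))`. -/
def chernClassPolytope : EquivCohomology P := chernClass (isCartier_polytope P)

variable (P) in
/-- The class `[D_{P(h)}] = ∑ (c_ρ + h_ρ) F_ρ` of the real divisor `D_{P(h)} = ∑ (c_ρ + h_ρ) D_ρ`. -/
def dilationClass (h : ι → ℝ) : EquivCohomology P := ∑ ρ, scalar ((P.c ρ : ℝ) + h ρ) * F P ρ

/-- The finite group `G_σ`: all `(t_ρ) ∈ (ℂ*)^{Σ(1)}` with `∏ u_ρ(t_ρ) = 1` in `T`, and `t_ρ = 1` for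
`ρ ∉ σ(1)`. -/
def stabilizer (σ : P.MaxCone) : Subgroup (ι → ℂˣ) where
  carrier := {t | (∀ i, ∏ ρ, t ρ ^ P.u ρ i = 1) ∧ ∀ ρ, ρ ∉ σ.rays → t ρ = 1}
  mul_mem' := fun {s t} hs ht =>
    ⟨fun i => by simp [mul_zpow, Finset.prod_mul_distrib, hs.1 i, ht.1 i],
      fun ρ hρ => by simp [hs.2 ρ hρ, ht.2 ρ hρ]⟩
  one_mem' := ⟨fun i => by simp, fun _ _ => rfl⟩
  inv_mem' := fun {t} ht =>
    ⟨fun i => by simp [ht.1 i], fun ρ hρ => by simp [ht.2 ρ hρ]⟩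

/-- The multiplicity `mult(σ) = |G_σ|`. -/
def mult (σ : P.MaxCone) : ℕ := Nat.card (stabilizer σ)

/-- The generalized equivariant Euler class `Eu_X^T(x_σ) = i_σ^*(mult(σ) ∏_{ρ ∈ σ(1)} [D_ρ]_T)`. -/
def eulerClass (σ : P.MaxCone) : PtCohomology n :=
  pullback σ (scalar (mult σ : ℝ) * ∏ ρ ∈ σ.rays, F P ρ)

end Toric

end

/-!
Write `w_{σ,ρ}` (`dualVec`) for the basis of `M_ℝ` dual to the ray generators of a maximal cone `σ`.
These vectors are the edge directions of `P` at the vertex of `σ`. On the topological side nothing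
is left but linear algebra: `F_ρ` restricts at `x_σ` to the linear form `-⟨w_{σ,ρ}, ·⟩` (`evalAt_F`),
so `[D_{P(h)}]` restricts to the vertex `v_σ(h) = -∑ (c_ρ + h_ρ) w_{σ,ρ}` of `P(h)`
(`evalAt_dilationClass`), and `mult(σ)` counts the characters of the cokernel of the matrix of ray
generators, so that it is the absolute value of its determinant (`mult_eq_natAbs_det`). The theorem
becomes Brion's formula
`∫_{P(h)} e^{⟨m, z⟩} dm = ∑_σ |det σ|⁻¹ e^{⟨v_σ(h), z⟩} / ∏_{ρ ∈ σ(1)} (-⟨w_{σ,ρ}, z⟩)`.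

Brion's formula follows from Stokes' theorem, applied to `P(h)`, its facets, and so on down to the
vertices. If `a` is tangent to a face `τ` (a set of facets), then `⟨a, z⟩` times the integral of
`e^{⟨m, z⟩}` over the face is `-∑_{ρ ∉ τ} ⟨a, u_ρ⟩` times the integral over the face `τ ∪ {ρ}`. Taking
for `a` an edge direction `w_{σ,ρ}`, where `⟨a, z⟩ ≠ 0` by assumption, and using
`a = ∑_ρ ⟨a, u_ρ⟩ w_{σ,ρ}` for every vertex `σ` of the face, downward induction on the dimension gives
the integral over a face as a sum over its vertices (`faceIntegral_eq_sum`).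

To avoid measures on faces, the indicator functions of the half-spaces are replaced by the smooth
functions `softStep δ`, and the delta functions of the facet hyperplanes by their derivatives. The
recursion is then integration by parts on `ℝⁿ` (`pairC_mul_integral_expProd`) and holds exactly for
every small `δ > 0`; at a vertex the smoothed integral factors into one-dimensional integrals
(`faceIntegral_rays`), and the formula is the limit `δ → 0`. What is needed of the geometry of `P` is
that facets which nearly meet, nearly inside `P`, belong to a common vertex, with a uniform error
bound (`exists_maxCone_of_nearly_active`, `exists_gap`). This bound is obtained by compactness and
provides `ε`.
-/

noncomputable section

namespace Toric

variable {n : ℕ} {ι : Type*} [Fintype ι] {P : SimpleLatticePolytope n ι}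

/-! ### Dual bases of the maximal cones and restrictions to the fixed points -/

/-- An enumeration of the rays of a maximal cone. -/
def rayEquiv (σ : P.MaxCone) : Fin n ≃ σ.rays :=
  (σ.rays.equivFinOfCardEq (card_rays σ)).symm

/-- The integral matrix whose rows are the ray generators of a maximal cone. -/
def rayMatrix (σ : P.MaxCone) : Matrix (Fin n) (Fin n) ℤ :=
  Matrix.of fun i j => P.u (rayEquiv σ i) j

/-- `rayMatrix` with real entries. -/
def realRayMatrix (σ : P.MaxCone) : Matrix (Fin n) (Fin n) ℝ :=
  (rayMatrix σ).map (Int.cast : ℤ → ℝ)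

lemma realRayMatrix_mulVec (σ : P.MaxCone) (x : Fin n → ℝ) (i : Fin n) :
    (realRayMatrix σ).mulVec x i = pairR x (P.u (rayEquiv σ i)) := by
  simp [realRayMatrix, rayMatrix, Matrix.mulVec, dotProduct, pairR, mul_comm]

lemma det_realRayMatrix (σ : P.MaxCone) :
    (realRayMatrix σ).det = ((rayMatrix σ).det : ℝ) :=
  (Int.cast_det (rayMatrix σ)).symm

lemma det_realRayMatrix_ne_zero (σ : P.MaxCone) : (realRayMatrix σ).det ≠ 0 := by
  intro h
  obtain ⟨x, hx, h0⟩ := Matrix.exists_mulVec_eq_zero_iff.2 h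
  refine hx (eq_zero_of_pairR σ x fun ρ hρ => ?_)
  have := congrFun h0 ((rayEquiv σ).symm ⟨ρ, hρ⟩)
  rwa [realRayMatrix_mulVec, Equiv.apply_symm_apply] at this

open Classical in
/-- The basis of `M_ℝ` dual to the ray generators of `σ`, extended by zero to the rays outside `σ`.
Its members are the directions of the edges of `P` at the vertex belonging to `σ`. -/
def dualVec (σ : P.MaxCone) (ρ : ι) : Fin n → ℝ :=
  if h : ρ ∈ σ.rays then (realRayMatrix σ)⁻¹.col ((rayEquiv σ).symm ⟨ρ, h⟩) else 0

lemma dualVec_of_notMem {σ : P.MaxCone} {ρ : ι} (h : ρ ∉ σ.rays) : dualVec σ ρ = 0 := by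
  rw [dualVec, dif_neg h]

lemma pairR_dualVec_self {σ : P.MaxCone} {ρ : ι} (h : ρ ∈ σ.rays) :
    pairR (dualVec σ ρ) (P.u ρ) = 1 := by
  have hu : IsUnit (realRayMatrix σ).det := (det_realRayMatrix_ne_zero σ).isUnit
  have := realRayMatrix_mulVec σ (dualVec σ ρ) ((rayEquiv σ).symm ⟨ρ, h⟩)
  rw [Equiv.apply_symm_apply] at this
  rw [← this, dualVec, dif_pos h, ← Matrix.mulVec_single_one, Matrix.mulVec_mulVec,
    Matrix.mul_nonsing_inv _ hu]
  simp

lemma pairR_dualVec_of_ne {σ : P.MaxCone} {ρ ρ' : ι} (h' : ρ' ∈ σ.rays) (hne : ρ ≠ ρ') :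
    pairR (dualVec σ ρ) (P.u ρ') = 0 := by
  by_cases h : ρ ∈ σ.rays
  · have hu : IsUnit (realRayMatrix σ).det := (det_realRayMatrix_ne_zero σ).isUnit
    have := realRayMatrix_mulVec σ (dualVec σ ρ) ((rayEquiv σ).symm ⟨ρ', h'⟩)
    rw [Equiv.apply_symm_apply] at this
    rw [← this, dualVec, dif_pos h, ← Matrix.mulVec_single_one, Matrix.mulVec_mulVec,
      Matrix.mul_nonsing_inv _ hu, Matrix.one_mulVec, Pi.single_apply, if_neg]
    rw [EmbeddingLike.apply_eq_iff_eq, Subtype.mk.injEq]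
    exact hne.symm
  · simp [dualVec_of_notMem h, pairR]

lemma pairR_sum_smul {κ : Type*} (s : Finset κ) (a : κ → ℝ) (x : κ → Fin n → ℝ)
    (u : Fin n → ℤ) : pairR (∑ k ∈ s, a k • x k) u = ∑ k ∈ s, a k * pairR (x k) u := by
  classical
  induction s using Finset.induction_on with
  | empty => simp [pairR]
  | insert k s hk ih => rw [Finset.sum_insert hk, Finset.sum_insert hk, pairR_add, pairR_smul, ih]

lemma pairR_sum_dualVec {σ : P.MaxCone} (a : ι → ℝ) {ρ : ι} (hρ : ρ ∈ σ.rays) :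
    pairR (∑ ρ' ∈ σ.rays, a ρ' • dualVec σ ρ') (P.u ρ) = a ρ := by
  rw [pairR_sum_smul, Finset.sum_eq_single_of_mem ρ hρ]
  · rw [pairR_dualVec_self hρ, mul_one]
  · intro ρ' _ hne
    rw [pairR_dualVec_of_ne hρ hne, mul_zero]

/-- Two points of `M_ℝ` are equal if all ray generators of `σ` agree on them. -/
lemma ext_of_pairR (σ : P.MaxCone) {x y : Fin n → ℝ}
    (h : ∀ ρ ∈ σ.rays, pairR x (P.u ρ) = pairR y (P.u ρ)) : x = y := by
  refine sub_eq_zero.1 (eq_zero_of_pairR σ _ fun ρ hρ => ?_)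
  have := pairR_smul (-1) y (P.u ρ)
  rw [sub_eq_add_neg, pairR_add, ← neg_one_smul ℝ y, this, h ρ hρ]
  ring

lemma eq_sum_dualVec (σ : P.MaxCone) (x : Fin n → ℝ) :
    x = ∑ ρ ∈ σ.rays, pairR x (P.u ρ) • dualVec σ ρ :=
  ext_of_pairR σ fun _ hρ => (pairR_sum_dualVec (fun ρ => pairR x (P.u ρ)) hρ).symm

lemma pairC_add (x y : Fin n → ℝ) (z : Fin n → ℂ) : pairC (x + y) z = pairC x z + pairC y z := by
  simp [pairC, add_mul, Finset.sum_add_distrib]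

lemma pairC_smul (a : ℝ) (x : Fin n → ℝ) (z : Fin n → ℂ) : pairC (a • x) z = a * pairC x z := by
  simp [pairC, Finset.mul_sum, mul_assoc]

lemma pairC_sum_smul {κ : Type*} (s : Finset κ) (a : κ → ℝ) (x : κ → Fin n → ℝ)
    (z : Fin n → ℂ) : pairC (∑ k ∈ s, a k • x k) z = ∑ k ∈ s, (a k : ℂ) * pairC (x k) z := by
  classical
  induction s using Finset.induction_on with
  | empty => simp [pairC]
  | insert k s hk ih => rw [Finset.sum_insert hk, Finset.sum_insert hk, pairC_add, pairC_smul, ih]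

lemma pairC_eq_sum_dualVec (σ : P.MaxCone) (x : Fin n → ℝ) (z : Fin n → ℂ) :
    pairC x z = ∑ ρ ∈ σ.rays, (pairR x (P.u ρ) : ℂ) * pairC (dualVec σ ρ) z := by
  conv_lhs => rw [eq_sum_dualVec σ x, pairC_sum_smul]

lemma evalAt_scalar (σ : P.MaxCone) (a : ℝ) (z : Fin n → ℂ) :
    evalAt z (pullback σ (scalar (P := P) a)) = a := by
  rw [scalar, AlgHom.commutes, Algebra.algebraMap_self, RingHom.id_apply, evalAt,
    MvPolynomial.aeval_C]
  rfl

lemma evalAt_chernPt_neg (m : Fin n → ℤ) (z : Fin n → ℂ) :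
    evalAt z (chernPt (-m)) = pairC (latticePoint m) z := by
  simp [chernPt, evalAt, pairC, latticePoint]

/-- If the Cartier divisor `D` is cut out near `x_σ` by `χ^{-x}`, then its Chern class restricts to
the linear form `⟨x, ·⟩`. -/
lemma evalAt_chernClass (σ : P.MaxCone) {D : ι → ℤ} (hD : IsCartier P D) {x : Fin n → ℝ}
    (hx : ∀ ρ ∈ σ.rays, pairR x (P.u ρ) = -D ρ) (z : Fin n → ℂ) :
    evalAt z (pullback σ (chernClass hD)) = pairC x z := by
  obtain ⟨m, hm⟩ := hD σ
  have e : x = latticePoint m := ext_of_pairR σ fun ρ hρ => by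
    rw [hx ρ hρ, pairR_latticePoint, hm ρ hρ, Int.cast_neg]
  change evalAt z (chernPt (fibreCharacter hD σ)) = _
  rw [fibreCharacter_eq hD σ hm, evalAt_chernPt_neg, e]

lemma cartierIndex_pos (D : ι → ℤ) : 0 < cartierIndex P D := by
  classical
  exact (Nat.find_spec (exists_isCartier P D)).1

lemma evalAt_divisorClass (σ : P.MaxCone) {D : ι → ℤ} {x : Fin n → ℝ}
    (hx : ∀ ρ ∈ σ.rays, pairR x (P.u ρ) = -D ρ) (z : Fin n → ℂ) :
    evalAt z (pullback σ (divisorClass P D)) = pairC x z := by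
  have hk : (cartierIndex P D : ℂ) ≠ 0 := by exact_mod_cast (cartierIndex_pos D).ne'
  rw [divisorClass, map_mul, map_mul, evalAt_scalar,
    evalAt_chernClass σ _ (x := (cartierIndex P D : ℝ) • x), pairC_smul]
  · push_cast
    rw [inv_mul_cancel_left₀ hk]
  · intro ρ hρ
    rw [pairR_smul, hx ρ hρ]
    push_cast
    ring

/-- The restriction of `[D_ρ]_T` to `x_σ` is minus the dual basis vector of `ρ`, regarded as a
linear form on `N_ℂ`. -/
lemma evalAt_F (σ : P.MaxCone) (ρ : ι) (z : Fin n → ℂ) :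
    evalAt z (pullback σ (F P ρ)) = -pairC (dualVec σ ρ) z := by
  classical
  rw [F, evalAt_divisorClass σ (x := (-1 : ℝ) • dualVec σ ρ), pairC_smul]
  · push_cast
    ring
  · intro ρ' hρ'
    rw [pairR_smul]
    rcases eq_or_ne ρ ρ' with rfl | hne
    · rw [pairR_dualVec_self hρ']
      simp
    · rw [pairR_dualVec_of_ne hρ' hne]
      simp [hne.symm]

/-- The vertex of `P(h)` belonging to `σ`: the point at which all inequalities
`⟨m, u_ρ⟩ + c_ρ + h_ρ ≥ 0` with `ρ ∈ σ(1)` are equalities. -/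
def dilationVertex (σ : P.MaxCone) (h : ι → ℝ) : Fin n → ℝ :=
  ∑ ρ ∈ σ.rays, (-(P.c ρ + h ρ)) • dualVec σ ρ

lemma pairR_dilationVertex {σ : P.MaxCone} (h : ι → ℝ) {ρ : ι} (hρ : ρ ∈ σ.rays) :
    pairR (dilationVertex σ h) (P.u ρ) + (P.c ρ + h ρ) = 0 := by
  rw [dilationVertex, pairR_sum_dualVec (fun ρ => -((P.c ρ : ℝ) + h ρ)) hρ]
  ring

lemma evalAt_dilationClass_eq_sum (σ : P.MaxCone) (h : ι → ℝ) (z : Fin n → ℂ) :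
    evalAt z (pullback σ (dilationClass P h)) =
      ∑ ρ, ((P.c ρ : ℂ) + h ρ) * evalAt z (pullback σ (F P ρ)) := by
  simp only [dilationClass, map_sum, map_mul, evalAt_scalar]
  push_cast
  rfl

/-- The class `[D_{P(h)}]` restricts at `x_σ` to the corresponding vertex of `P(h)`. -/
lemma evalAt_dilationClass (σ : P.MaxCone) (h : ι → ℝ) (z : Fin n → ℂ) :
    evalAt z (pullback σ (dilationClass P h)) = pairC (dilationVertex σ h) z := by
  classical
  rw [evalAt_dilationClass_eq_sum, dilationVertex, pairC_sum_smul]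
  symm
  refine Finset.sum_subset_zero_on_sdiff (Finset.subset_univ _) (fun ρ hρ => ?_) fun ρ _ => ?_
  · rw [evalAt_F, dualVec_of_notMem (Finset.mem_sdiff.1 hρ).2]
    simp [pairC]
  · rw [evalAt_F]
    push_cast
    ring

lemma evalAt_dilationClass_eq_add (σ : P.MaxCone) (h : ι → ℝ) (z : Fin n → ℂ) :
    evalAt z (pullback σ (dilationClass P h)) =
      evalAt z (pullback σ (chernClassPolytope P)) +
        ∑ ρ, (h ρ : ℂ) * evalAt z (pullback σ (F P ρ)) := by
  have h0 : evalAt z (pullback σ (chernClassPolytope P)) =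
      ∑ ρ, (P.c ρ : ℂ) * evalAt z (pullback σ (F P ρ)) := by
    have := evalAt_dilationClass_eq_sum σ 0 z
    rw [evalAt_dilationClass] at this
    rw [chernClassPolytope, evalAt_chernClass σ _ (x := dilationVertex σ 0), this]
    · simp
    · intro ρ hρ
      have := pairR_dilationVertex 0 hρ
      simp only [Pi.zero_apply, add_zero] at this
      linarith
  rw [evalAt_dilationClass_eq_sum, h0, ← Finset.sum_add_distrib]
  exact Finset.sum_congr rfl fun ρ _ => add_mul _ _ _

lemma evalAt_eulerClass_eq_mult_mul (σ : P.MaxCone) (z : Fin n → ℂ) :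
    evalAt z (eulerClass σ) = (mult σ : ℂ) * ∏ ρ ∈ σ.rays, (-pairC (dualVec σ ρ) z) := by
  simp only [eulerClass, map_mul, map_prod, evalAt_scalar, evalAt_F]
  push_cast
  rfl

/-! ### The multiplicity of a cone as a determinant -/

/-- The cokernel of a nonsingular integral matrix has `|det A|` elements. -/
lemma card_quotient_range_mulVecLin (A : Matrix (Fin n) (Fin n) ℤ) (hA : A.det ≠ 0) :
    Nat.card ((Fin n → ℤ) ⧸ LinearMap.range A.mulVecLin) = A.det.natAbs := by
  have hinj : Function.Injective A.mulVecLin := by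
    rw [← LinearMap.ker_eq_bot, LinearMap.ker_eq_bot']
    intro x hx
    by_contra h0
    exact hA (Matrix.exists_mulVec_eq_zero_iff.1 ⟨x, h0, hx⟩)
  rw [← Submodule.natAbs_det_equiv _ (LinearEquiv.ofInjective A.mulVecLin hinj)]
  have : (LinearMap.range A.mulVecLin).subtype ∘ₗ AddMonoidHom.toIntLinearMap
      ((LinearEquiv.ofInjective A.mulVecLin hinj : (Fin n → ℤ) ≃ₗ[ℤ] _) :
        (Fin n → ℤ) →+ LinearMap.range A.mulVecLin) = Matrix.toLin' A := by
    ext x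
    rfl
  rw [this, LinearMap.det_toLin']

/-- The homomorphism `ℤⁿ → ℂˣ` with prescribed values on the standard basis. -/
def powerHom (t : Fin n → ℂˣ) : (Fin n → ℤ) →+ Additive ℂˣ where
  toFun a := Additive.ofMul (∏ j, t j ^ a j)
  map_zero' := by simp
  map_add' a b := by simp [zpow_add, Finset.prod_mul_distrib]

lemma hom_apply_eq_prod (φ : (Fin n → ℤ) →+ Additive ℂˣ) (a : Fin n → ℤ) :
    (φ a).toMul = ∏ j, (φ (Pi.single j 1)).toMul ^ a j := by
  have : φ = powerHom fun j => (φ (Pi.single j 1)).toMul := by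
    ext j
    simp [powerHom, Pi.single_apply]
  conv_lhs => rw [this]
  rfl

/-- The tuples killed by an integral matrix are the characters of its cokernel. -/
lemma card_tuples_eq_natAbs_det (A : Matrix (Fin n) (Fin n) ℤ) (hA : A.det ≠ 0) :
    Nat.card {t : Fin n → ℂˣ // ∀ i, ∏ j, t j ^ A j i = 1} = A.det.natAbs := by
  set Q := (Fin n → ℤ) ⧸ LinearMap.range A.mulVecLin with hQ
  have hcard : Nat.card Q = A.det.natAbs := card_quotient_range_mulVecLin A hA
  have : Finite Q := Nat.finite_of_card_ne_zero (by rw [hcard]; exact Int.natAbs_ne_zero.2 hA)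
  rw [← hcard, Nat.card_congr (Multiplicative.ofAdd : Q ≃ Multiplicative Q),
    ← CommGroup.card_monoidHom_of_hasEnoughRootsOfUnity (Multiplicative Q) ℂ]
  symm
  let pull (φ : Multiplicative Q →* ℂˣ) : (Fin n → ℤ) →+ Additive ℂˣ :=
    (MonoidHom.toAdditiveRight φ).comp (LinearMap.range A.mulVecLin).mkQ.toAddMonoidHom
  have hpull : ∀ φ, ∀ i, pull φ (fun j => A j i) = 0 := by
    intro φ i
    have h0 : (LinearMap.range A.mulVecLin).mkQ (fun j => A j i) = 0 := by
      rw [Submodule.mkQ_apply, Submodule.Quotient.mk_eq_zero]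
      exact ⟨Pi.single i 1, by ext j; simp⟩
    change MonoidHom.toAdditiveRight φ ((LinearMap.range A.mulVecLin).mkQ _) = 0
    rw [h0, map_zero]
  refine Nat.card_eq_of_bijective (fun φ => ⟨fun j => (pull φ (Pi.single j 1)).toMul, fun i => ?_⟩)
    ⟨fun φ ψ h => ?_, fun t => ?_⟩
  · rw [← hom_apply_eq_prod (pull φ) (fun j => A j i), hpull]
    rfl
  · have e : pull φ = pull ψ := by
      ext j
      have := congrFun (Subtype.ext_iff.1 h) j
      simpa using congrArg (Units.val) this
    refine MonoidHom.ext fun q => ?_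
    obtain ⟨a, ha⟩ := (LinearMap.range A.mulVecLin).mkQ_surjective (Multiplicative.toAdd q)
    have := DFunLike.congr_fun e a
    change Additive.ofMul (φ (Multiplicative.ofAdd ((LinearMap.range A.mulVecLin).mkQ a))) =
      Additive.ofMul (ψ (Multiplicative.ofAdd ((LinearMap.range A.mulVecLin).mkQ a))) at this
    rw [ha] at this
    exact this
  · have hker : (LinearMap.range A.mulVecLin) ≤ LinearMap.ker (powerHom t.1).toIntLinearMap := by
      rintro _ ⟨x, rfl⟩
      rw [LinearMap.mem_ker]
      have : A.mulVecLin x = ∑ i, x i • fun j => A j i := by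
        ext j
        simp [Matrix.mulVec, dotProduct, mul_comm]
      rw [this, map_sum]
      refine Finset.sum_eq_zero fun i _ => ?_
      rw [map_smul]
      have h0 : (powerHom t.1).toIntLinearMap (fun j => A j i) = 0 :=
        congrArg Additive.ofMul (t.2 i)
      rw [h0, smul_zero]
    let φ : Multiplicative Q →* ℂˣ :=
      MonoidHom.toAdditiveRight.symm
        ((LinearMap.range A.mulVecLin).liftQ (powerHom t.1).toIntLinearMap hker).toAddMonoidHom
    refine ⟨φ, Subtype.ext (funext fun j => ?_)⟩
    change ∏ k, t.1 k ^ (Pi.single j (1 : ℤ) : Fin n → ℤ) k = t.1 j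
    simp [Pi.single_apply]

/-- The multiplicity of a cone is the index of the sublattice generated by its rays. -/
lemma mult_eq_natAbs_det (σ : P.MaxCone) : mult σ = (rayMatrix σ).det.natAbs := by
  classical
  have hdet : (rayMatrix σ).det ≠ 0 := fun h =>
    det_realRayMatrix_ne_zero σ (by rw [det_realRayMatrix, h, Int.cast_zero])
  rw [← card_tuples_eq_natAbs_det _ hdet, mult]
  have hprod : ∀ (t : ι → ℂˣ) (i : Fin n), (∀ ρ, ρ ∉ σ.rays → t ρ = 1) →
      ∏ ρ, t ρ ^ P.u ρ i = ∏ j, t (rayEquiv σ j) ^ rayMatrix σ j i := by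
    intro t i ht
    rw [← Finset.prod_subset (Finset.subset_univ σ.rays)
      (fun ρ _ hρ => by rw [ht ρ hρ, one_zpow]), ← Finset.prod_coe_sort,
      ← (rayEquiv σ).prod_comp]
    rfl
  refine Nat.card_congr
    { toFun := fun t => ⟨fun j => t.1 (rayEquiv σ j), fun i => ?_⟩
      invFun := fun t => ⟨fun ρ =>
        if h : ρ ∈ σ.rays then t.1 ((rayEquiv σ).symm ⟨ρ, h⟩) else 1, ?_⟩
      left_inv := fun t => ?_
      right_inv := fun t => ?_ }
  · rw [← hprod t.1 i t.2.2]
    exact t.2.1 i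
  · have h1 : ∀ ρ, ρ ∉ σ.rays →
        (if h : ρ ∈ σ.rays then t.1 ((rayEquiv σ).symm ⟨ρ, h⟩) else 1) = 1 :=
      fun ρ hρ => dif_neg hρ
    refine ⟨fun i => ?_, h1⟩
    rw [hprod _ i h1]
    simpa using t.2 i
  · ext ρ
    by_cases h : ρ ∈ σ.rays
    · simp [h]
    · simp [h, t.2.2 ρ h]
  · ext j
    simp

lemma evalAt_eulerClass (σ : P.MaxCone) (z : Fin n → ℂ) :
    evalAt z (eulerClass σ) =
      (|(realRayMatrix σ).det| : ℝ) * ∏ ρ ∈ σ.rays, (-pairC (dualVec σ ρ) z) := by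
  have h : |(realRayMatrix σ).det| = (((rayMatrix σ).det.natAbs : ℕ) : ℝ) := by
    rw [det_realRayMatrix, Nat.cast_natAbs, Int.cast_abs]
  rw [evalAt_eulerClass_eq_mult_mul, mult_eq_natAbs_det, h, Complex.ofReal_natCast]

/-! ### Compactness and the faces near a point of a dilated polytope -/

lemma continuous_pairR (u : Fin n → ℤ) : Continuous fun m : Fin n → ℝ => pairR m u := by
  unfold pairR
  fun_prop

lemma isClosed_polyhedron {κ : Type*} (u : κ → Fin n → ℤ) (b : κ → ℝ) :
    IsClosed (polyhedron u b) := by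
  rw [polyhedron, Set.ofPred_forall]
  exact isClosed_iInter fun ρ =>
    isClosed_le continuous_const ((continuous_pairR (u ρ)).add continuous_const)

lemma isCompact_carrier (P : SimpleLatticePolytope n ι) : IsCompact P.carrier := by
  obtain ⟨V, hV⟩ := P.lattice
  rw [SimpleLatticePolytope.carrier, hV]
  exact (V.finite_toSet.image latticePoint).isCompact_convexHull ℝ

/-- All inequalities are strict at an interior point of `P`. -/
lemma exists_strict_point (P : SimpleLatticePolytope n ι) :
    ∃ p : Fin n → ℝ, ∀ ρ, 0 < pairR p (P.u ρ) + P.c ρ := by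
  obtain ⟨p, hp⟩ := P.full
  refine ⟨p, fun ρ => ?_⟩
  have hu : 0 < pairR (latticePoint (P.u ρ)) (P.u ρ) := by
    have hnn : ∀ i ∈ Finset.univ, 0 ≤ latticePoint (P.u ρ) i * (P.u ρ i : ℝ) :=
      fun i _ => mul_self_nonneg _
    refine lt_of_le_of_ne (Finset.sum_nonneg hnn) fun h => ?_
    have h0 := (Finset.sum_eq_zero_iff_of_nonneg hnn).1 h.symm
    have hz : Finset.univ.gcd (P.u ρ) = 0 := by
      rw [Finset.gcd_eq_zero_iff]
      intro i hi
      simpa [latticePoint] using h0 i hi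
    rw [P.primitive ρ] at hz
    exact one_ne_zero hz
  -- A small step from `p` against `u_ρ` stays in `P` and decreases the value of the inequality.
  have hc : Filter.Tendsto (fun t : ℝ => p + (-t) • latticePoint (P.u ρ)) (nhds 0) (nhds p) := by
    have : Continuous fun t : ℝ => p + (-t) • latticePoint (P.u ρ) := by fun_prop
    simpa using this.tendsto 0
  have h1 := hc.eventually (mem_interior_iff_mem_nhds.1 hp)
  obtain ⟨t, ht, ht0⟩ := ((h1.filter_mono nhdsWithin_le_nhds).and
    (eventually_mem_nhdsWithin : ∀ᶠ t in nhdsWithin (0 : ℝ) (Set.Ioi 0), t ∈ Set.Ioi 0)).exists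
  have h2 := ht ρ
  rw [pairR_add, pairR_smul] at h2
  have := mul_pos (show (0 : ℝ) < t from ht0) hu
  linarith

lemma isCompact_polyhedron (P : SimpleLatticePolytope n ι) (b : ι → ℝ) :
    IsCompact (polyhedron P.u b) := by
  refine Metric.isCompact_of_isClosed_isBounded (isClosed_polyhedron _ _) ?_
  obtain ⟨p, hp⟩ := exists_strict_point P
  -- A homothety centred at an interior point of `P` moves the polyhedron into `P`.
  have : ∀ᶠ s in nhdsWithin (0 : ℝ) (Set.Ioi 0),
      ∀ ρ, 0 < (1 - s) * (pairR p (P.u ρ) + P.c ρ) + s * (P.c ρ - b ρ) := by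
    refine Filter.Eventually.filter_mono nhdsWithin_le_nhds (Filter.eventually_all.2 fun ρ => ?_)
    have hc : ContinuousAt (fun s : ℝ =>
      (1 - s) * (pairR p (P.u ρ) + P.c ρ) + s * (P.c ρ - b ρ)) 0 := by fun_prop
    exact hc.eventually (lt_mem_nhds (by simpa using hp ρ))
  obtain ⟨s, hs, hs0⟩ := (this.and
    (eventually_mem_nhdsWithin : ∀ᶠ t in nhdsWithin (0 : ℝ) (Set.Ioi 0), t ∈ Set.Ioi 0)).exists
  have hs0' : 0 < s := hs0
  have hb : Bornology.IsBounded ((fun x => s⁻¹ • (x + (-(1 - s)) • p)) '' P.carrier) :=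
    ((isCompact_carrier P).image (by fun_prop)).isBounded
  refine hb.subset fun m hm => ⟨(1 - s) • p + s • m, fun ρ => ?_, ?_⟩
  · have h1 := hs ρ
    have h2 := mul_nonneg hs0'.le (hm ρ)
    rw [pairR_add, pairR_smul, pairR_smul]
    linarith
  · change s⁻¹ • ((1 - s) • p + s • m + (-(1 - s)) • p) = m
    rw [neg_smul, add_neg_cancel_comm, inv_smul_smul₀ hs0'.ne']

/-- The inequalities that are equalities at a point of `P` are among those of some vertex. -/
lemma exists_maxCone_of_active {m : Fin n → ℝ} (hm : m ∈ P.carrier) :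
    ∃ σ : P.MaxCone, ∀ ρ, pairR m (P.u ρ) + P.c ρ = 0 → ρ ∈ σ.rays := by
  classical
  set S : Set (Fin n → ℝ) := {x ∈ P.carrier | ∀ ρ, pairR m (P.u ρ) + P.c ρ = 0 →
    pairR x (P.u ρ) + P.c ρ = 0} with hS
  have hcl : IsClosed {x : Fin n → ℝ | ∀ ρ, pairR m (P.u ρ) + P.c ρ = 0 →
      pairR x (P.u ρ) + P.c ρ = 0} := by
    simp only [Set.ofPred_forall]
    exact isClosed_iInter fun ρ => isClosed_iInter fun _ =>
      isClosed_eq ((continuous_pairR (P.u ρ)).add continuous_const) continuous_const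
  obtain ⟨v, hv⟩ := ((isCompact_carrier P).inter_right hcl).extremePoints_nonempty
    ⟨m, hm, fun _ h => h⟩
  have hext : IsExtreme ℝ P.carrier S := by
    refine ⟨fun x hx => hx.1, fun x hx y hy w hw hwxy => ⟨hx, fun ρ hρ => ?_⟩⟩
    obtain ⟨a, b, ha, hb, hab, rfl⟩ := hwxy
    have h1 := hw.2 ρ hρ
    rw [pairR_add, pairR_smul, pairR_smul] at h1
    have h2 := hx ρ
    have h3 := mul_nonneg hb.le (hy ρ)
    have h4 : a * (pairR x (P.u ρ) + P.c ρ) + b * (pairR y (P.u ρ) + P.c ρ) = 0 := by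
      linear_combination h1 + (P.c ρ : ℝ) * hab
    have h5 : a * (pairR x (P.u ρ) + P.c ρ) = 0 := by
      have := mul_nonneg ha.le h2
      linarith
    exact (mul_eq_zero.1 h5).resolve_left ha.ne'
  refine ⟨⟨Finset.univ.filter fun ρ => pairR v (P.u ρ) + P.c ρ = 0, v,
    hext.extremePoints_subset_extremePoints hv, by simp⟩, fun ρ hρ => ?_⟩
  exact Finset.mem_filter.2 ⟨Finset.mem_univ _, hv.1.2 ρ hρ⟩

/-- By compactness, inequalities that are nearly equalities at a point that is nearly in `P` are
among those of some vertex. -/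
lemma exists_maxCone_of_nearly_active (P : SimpleLatticePolytope n ι) :
    ∃ ε : ℝ, 0 < ε ∧ ∀ m : Fin n → ℝ, (∀ ρ, -ε ≤ pairR m (P.u ρ) + P.c ρ) →
      ∃ σ : P.MaxCone, ∀ ρ, pairR m (P.u ρ) + P.c ρ ≤ ε → ρ ∈ σ.rays := by
  let Good (ε : ℝ) (m : Fin n → ℝ) : Prop := (∀ ρ, -ε ≤ pairR m (P.u ρ) + P.c ρ) →
    ∃ σ : P.MaxCone, ∀ ρ, pairR m (P.u ρ) + P.c ρ ≤ ε → ρ ∈ σ.rays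
  have hmono : ∀ {ε ε' m}, ε' ≤ ε → Good ε m → Good ε' m := by
    intro ε ε' m hle h h'
    obtain ⟨σ, hσ⟩ := h fun ρ => by linarith [h' ρ]
    exact ⟨σ, fun ρ hρ => hσ ρ (hρ.trans hle)⟩
  have hK := isCompact_polyhedron P fun ρ => (P.c ρ : ℝ) + 1
  obtain ⟨ε, hε, h⟩ : ∃ ε : ℝ, 0 < ε ∧
      ∀ m ∈ polyhedron P.u (fun ρ => (P.c ρ : ℝ) + 1), Good ε m := by
    refine hK.induction_on (p := fun s => ∃ ε : ℝ, 0 < ε ∧ ∀ m ∈ s, Good ε m)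
      ⟨1, one_pos, by simp⟩ ?_ ?_ ?_
    · rintro s t hst ⟨ε, hε, h⟩
      exact ⟨ε, hε, fun m hm => h m (hst hm)⟩
    · rintro s t ⟨ε, hε, h⟩ ⟨ε', hε', h'⟩
      refine ⟨min ε ε', lt_min hε hε', ?_⟩
      rintro m (hm | hm)
      · exact hmono (min_le_left _ _) (h m hm)
      · exact hmono (min_le_right _ _) (h' m hm)
    · intro m _
      have hcont : ∀ ρ, Continuous fun x : Fin n → ℝ => pairR x (P.u ρ) + P.c ρ := fun ρ =>
        (continuous_pairR (P.u ρ)).add continuous_const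
      by_cases hmP : m ∈ P.carrier
      · obtain ⟨σ, hσ⟩ := exists_maxCone_of_active hmP
        have hpos : ∀ ρ, ∃ ε : ℝ, 0 < ε ∧ (ρ ∉ σ.rays → ε < pairR m (P.u ρ) + P.c ρ) := by
          intro ρ
          by_cases hρ : ρ ∈ σ.rays
          · exact ⟨1, one_pos, fun h => absurd hρ h⟩
          · have : 0 < pairR m (P.u ρ) + P.c ρ :=
              lt_of_le_of_ne (hmP ρ) fun e => hρ (hσ ρ e.symm)
            exact ⟨_, half_pos this, fun _ => half_lt_self this⟩
        choose ε hε hε' using hpos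
        obtain ⟨ε₀, hε₀, hle⟩ : ∃ ε₀ : ℝ, 0 < ε₀ ∧ ∀ ρ, ε₀ ≤ ε ρ := by
          have : ∀ᶠ t in nhdsWithin (0 : ℝ) (Set.Ioi 0), ∀ ρ, t ≤ ε ρ :=
            Filter.Eventually.filter_mono nhdsWithin_le_nhds
              (Filter.eventually_all.2 fun ρ => (ge_mem_nhds (hε ρ)))
          obtain ⟨t, ht, ht0⟩ := (this.and (eventually_mem_nhdsWithin)).exists
          exact ⟨t, ht0, ht⟩
        refine ⟨{x | ∀ ρ, ρ ∉ σ.rays → ε ρ < pairR x (P.u ρ) + P.c ρ},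
          mem_nhdsWithin_of_mem_nhds (Filter.eventually_all.2 fun ρ => ?_), ε₀, hε₀,
          fun x hx _ => ⟨σ, fun ρ hρ => ?_⟩⟩
        · by_cases hρ : ρ ∈ σ.rays
          · exact Filter.Eventually.of_forall fun x h => absurd hρ h
          · filter_upwards [(hcont ρ).continuousAt.eventually (lt_mem_nhds (hε' ρ hρ))]
              with x hx _ using hx
        · by_contra hn
          exact absurd (hx ρ hn) (not_lt.2 (hρ.trans (hle ρ)))
      · obtain ⟨ρ, hρ⟩ := not_forall.1 hmP
        rw [not_le] at hρ
        refine ⟨{x | pairR x (P.u ρ) + P.c ρ < (pairR m (P.u ρ) + P.c ρ) / 2},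
          mem_nhdsWithin_of_mem_nhds ((hcont ρ).continuousAt.eventually
            (gt_mem_nhds (by linarith))),
          -((pairR m (P.u ρ) + P.c ρ) / 2), by linarith, fun x hx hx' => ?_⟩
        have h1 := hx' ρ
        rw [neg_neg] at h1
        exact absurd hx (not_lt.2 h1)
  refine ⟨min ε 1, lt_min hε one_pos, fun m hm => ?_⟩
  refine hmono (min_le_left _ _) (h m fun ρ => ?_) hm
  have := hm ρ
  have := min_le_right ε 1
  linarith

/-- Near a vertex, the inequalities that do not belong to it are strict. -/
lemma exists_gap (P : SimpleLatticePolytope n ι) :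
    ∃ ε : ℝ, 0 < ε ∧ ∀ σ : P.MaxCone, ∀ m : Fin n → ℝ,
      (∀ ρ ∈ σ.rays, |pairR m (P.u ρ) + P.c ρ| ≤ ε) →
      ∀ ρ, ρ ∉ σ.rays → ε ≤ pairR m (P.u ρ) + P.c ρ := by
  have key : ∀ σ : P.MaxCone, ∀ ρ, ∀ᶠ ε in nhds (0 : ℝ), ∀ m : Fin n → ℝ,
      (∀ ρ ∈ σ.rays, |pairR m (P.u ρ) + P.c ρ| ≤ ε) →
      ρ ∉ σ.rays → ε ≤ pairR m (P.u ρ) + P.c ρ := by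
    intro σ ρ
    by_cases hρ : ρ ∈ σ.rays
    · exact Filter.Eventually.of_forall fun ε m _ h => absurd hρ h
    obtain ⟨v, hv, hσ⟩ := σ.2
    have hpos : 0 < pairR v (P.u ρ) + P.c ρ :=
      lt_of_le_of_ne (hv.1 ρ) fun e => hρ ((hσ ρ).2 e.symm)
    have hc : ContinuousAt (fun ε : ℝ => pairR v (P.u ρ) + P.c ρ -
      ε * (∑ ρ' ∈ σ.rays, |pairR (dualVec σ ρ') (P.u ρ)|) - ε) 0 := by fun_prop
    filter_upwards [hc.eventually (lt_mem_nhds (a := 0) (by simpa using hpos))] with ε hε m hm _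
    -- The coordinates of `m - v` in the dual basis are the values of the inequalities of `σ`.
    have hmv : m = v + ∑ ρ' ∈ σ.rays, (pairR m (P.u ρ') + P.c ρ') • dualVec σ ρ' := by
      refine ext_of_pairR σ fun ρ' hρ' => ?_
      rw [pairR_add, pairR_sum_dualVec (fun ρ' => pairR m (P.u ρ') + P.c ρ') hρ']
      have := (hσ ρ').1 hρ'
      linarith
    have hle : -(ε * ∑ ρ' ∈ σ.rays, |pairR (dualVec σ ρ') (P.u ρ)|) ≤
        ∑ ρ' ∈ σ.rays, (pairR m (P.u ρ') + P.c ρ') * pairR (dualVec σ ρ') (P.u ρ) := by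
      refine (abs_le.1 ?_).1
      rw [Finset.mul_sum]
      refine (Finset.abs_sum_le_sum_abs _ _).trans (Finset.sum_le_sum fun ρ' hρ' => ?_)
      rw [abs_mul]
      exact mul_le_mul_of_nonneg_right (hm ρ' hρ') (abs_nonneg _)
    have hval : pairR m (P.u ρ) = pairR v (P.u ρ) +
        ∑ ρ' ∈ σ.rays, (pairR m (P.u ρ') + P.c ρ') * pairR (dualVec σ ρ') (P.u ρ) := by
      conv_lhs => rw [hmv, pairR_add, pairR_sum_smul]
    linarith
  have hall : ∀ᶠ ε in nhdsWithin (0 : ℝ) (Set.Ioi 0), ∀ σ : P.MaxCone, ∀ ρ, ∀ m : Fin n → ℝ,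
      (∀ ρ ∈ σ.rays, |pairR m (P.u ρ) + P.c ρ| ≤ ε) →
      ρ ∉ σ.rays → ε ≤ pairR m (P.u ρ) + P.c ρ :=
    Filter.Eventually.filter_mono nhdsWithin_le_nhds
      (Filter.eventually_all.2 fun σ => Filter.eventually_all.2 fun ρ => key σ ρ)
  obtain ⟨ε, h, hε⟩ := (hall.and eventually_mem_nhdsWithin).exists
  exact ⟨ε, hε, fun σ m hm ρ hρ => h σ ρ m hm hρ⟩

/-! ### Integration by parts for products of ridge functions -/

/-- The function `m ↦ e^{⟨m, z⟩} ∏_ρ g_ρ(⟨m, u_ρ⟩ + b_ρ)` on `M_ℝ`. -/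
def expProd (u : ι → Fin n → ℤ) (b : ι → ℝ) (z : Fin n → ℂ) (g : ι → ℝ → ℝ)
    (m : Fin n → ℝ) : ℂ :=
  Complex.exp (pairC m z) * ∏ ρ, (g ρ (pairR m (u ρ) + b ρ) : ℂ)

lemma continuous_pairC (z : Fin n → ℂ) : Continuous fun m : Fin n → ℝ => pairC m z := by
  unfold pairC
  fun_prop

lemma continuous_expProd (u : ι → Fin n → ℤ) (b : ι → ℝ) (z : Fin n → ℂ) {g : ι → ℝ → ℝ}
    (hg : ∀ ρ, Continuous (g ρ)) : Continuous (expProd u b z g) := by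
  unfold expProd
  refine (Complex.continuous_exp.comp (continuous_pairC z)).mul
    (continuous_finsetProd _ fun ρ _ => Complex.continuous_ofReal.comp ((hg ρ).comp ?_))
  exact (continuous_pairR (u ρ)).add continuous_const

lemma mem_polyhedron_of_expProd_ne_zero {u : ι → Fin n → ℤ} {b : ι → ℝ} {z : Fin n → ℂ}
    {g : ι → ℝ → ℝ} {δ : ℝ} (hδ : ∀ ρ, ∀ s < -δ, g ρ s = 0) {m : Fin n → ℝ}
    (hm : expProd u b z g m ≠ 0) : m ∈ polyhedron u fun ρ => b ρ + δ := by
  intro ρ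
  by_contra hneg
  refine hm (mul_eq_zero_of_right _ (Finset.prod_eq_zero (Finset.mem_univ ρ) ?_))
  rw [hδ ρ _ (by linarith), Complex.ofReal_zero]

lemma integrable_expProd (P : SimpleLatticePolytope n ι) (b : ι → ℝ) (z : Fin n → ℂ)
    {g : ι → ℝ → ℝ} (hg : ∀ ρ, Continuous (g ρ)) {δ : ℝ} (hδ : ∀ ρ, ∀ s < -δ, g ρ s = 0) :
    MeasureTheory.Integrable (expProd P.u b z g) :=
  (continuous_expProd P.u b z hg).integrable_of_hasCompactSupport
    (HasCompactSupport.intro (isCompact_polyhedron P fun ρ => b ρ + δ) fun m hm => by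
      by_contra h
      exact hm (mem_polyhedron_of_expProd_ne_zero hδ h))

lemma hasLineDerivAt_expProd [DecidableEq ι] (u : ι → Fin n → ℤ) (b : ι → ℝ) (z : Fin n → ℂ)
    {g : ι → ℝ → ℝ} (hg : ∀ ρ, Differentiable ℝ (g ρ)) (a m : Fin n → ℝ) :
    HasLineDerivAt ℝ (expProd u b z g)
      (pairC a z * expProd u b z g m + ∑ ρ, (pairR a (u ρ) : ℂ) *
        expProd u b z (Function.update g ρ (deriv (g ρ))) m) m a := by
  have hC : HasDerivAt (fun t : ℝ => Complex.exp (pairC (m + t • a) z))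
      (Complex.exp (pairC m z) * pairC a z) 0 := by
    have h1 : HasDerivAt (fun t : ℝ => pairC m z + (t : ℂ) * pairC a z) (1 * pairC a z) 0 :=
      (Complex.ofRealCLM.hasDerivAt.mul_const (pairC a z)).const_add (pairC m z)
    have h2 := h1.cexp
    simp only [Complex.ofReal_zero, zero_mul, add_zero, one_mul] at h2
    simpa only [pairC_add, pairC_smul] using h2
  have hR : ∀ ρ, HasDerivAt (fun t : ℝ => (g ρ (pairR (m + t • a) (u ρ) + b ρ) : ℂ))
      ((pairR a (u ρ) * deriv (g ρ) (pairR m (u ρ) + b ρ) : ℝ) : ℂ) 0 := by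
    intro ρ
    have h1 : HasDerivAt (fun t : ℝ => pairR (m + t • a) (u ρ) + b ρ) (pairR a (u ρ)) 0 := by
      simp only [pairR_add, pairR_smul]
      simpa using (((hasDerivAt_id (0 : ℝ)).mul_const (pairR a (u ρ))).const_add
        (pairR m (u ρ))).add_const (b ρ)
    have h2 : HasDerivAt (g ρ) (deriv (g ρ) (pairR m (u ρ) + b ρ))
        (pairR (m + (0 : ℝ) • a) (u ρ) + b ρ) := by
      rw [zero_smul, add_zero]
      exact ((hg ρ) _).hasDerivAt
    have h3 := (h2.comp (0 : ℝ) h1).ofReal_comp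
    rwa [mul_comm] at h3
  have hprod := HasDerivAt.fun_finsetProd (u := Finset.univ) fun ρ _ => hR ρ
  have h := hC.mul hprod
  unfold HasLineDerivAt
  refine (h.congr_deriv ?_)
  simp only [zero_smul, add_zero, expProd]
  rw [Finset.mul_sum]
  congr 1
  · ring
  refine Finset.sum_congr rfl fun ρ _ => ?_
  rw [← Finset.mul_prod_erase Finset.univ (fun ρ' =>
    (Function.update g ρ (deriv (g ρ)) ρ' (pairR m (u ρ') + b ρ') : ℂ)) (Finset.mem_univ ρ)]
  have : ∏ ρ' ∈ Finset.univ.erase ρ,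
      (Function.update g ρ (deriv (g ρ)) ρ' (pairR m (u ρ') + b ρ') : ℂ) =
      ∏ ρ' ∈ Finset.univ.erase ρ, (g ρ' (pairR m (u ρ') + b ρ') : ℂ) :=
    Finset.prod_congr rfl fun ρ' hρ' => by
      rw [Function.update_of_ne (Finset.ne_of_mem_erase hρ')]
  rw [this, Function.update_self, smul_eq_mul]
  push_cast
  ring

lemma deriv_eq_zero_of_forall_lt {f : ℝ → ℝ} {a : ℝ} (hf : ∀ s < a, f s = 0) {s : ℝ}
    (hs : s < a) : deriv f s = 0 := by
  have : f =ᶠ[nhds s] fun _ => 0 := by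
    filter_upwards [gt_mem_nhds hs] with t ht using hf t ht
  rw [this.deriv_eq, deriv_const]

/-- Stokes' theorem for `expProd`: the integral of its derivative in direction `a` vanishes. -/
lemma pairC_mul_integral_expProd [DecidableEq ι] (P : SimpleLatticePolytope n ι) (b : ι → ℝ)
    (z : Fin n → ℂ) {g : ι → ℝ → ℝ} (hg : ∀ ρ, ContDiff ℝ 1 (g ρ)) {δ : ℝ}
    (hδ : ∀ ρ, ∀ s < -δ, g ρ s = 0) (a : Fin n → ℝ) :
    pairC a z * ∫ m, expProd P.u b z g m =
      -∑ ρ, (pairR a (P.u ρ) : ℂ) *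
        ∫ m, expProd P.u b z (Function.update g ρ (deriv (g ρ))) m := by
  have hint := integrable_expProd P b z (fun ρ => (hg ρ).continuous) hδ
  have hint' : ∀ ρ, MeasureTheory.Integrable
      (expProd P.u b z (Function.update g ρ (deriv (g ρ)))) := by
    intro ρ
    refine integrable_expProd P b z (fun ρ' => ?_) (δ := δ) fun ρ' s hs => ?_
    · rcases eq_or_ne ρ' ρ with rfl | hne
      · rw [Function.update_self]
        exact (hg ρ').continuous_deriv le_rfl
      · rw [Function.update_of_ne hne]
        exact (hg ρ').continuous
    · rcases eq_or_ne ρ' ρ with rfl | hne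
      · rw [Function.update_self]
        exact deriv_eq_zero_of_forall_lt (hδ ρ') hs
      · rw [Function.update_of_ne hne]
        exact hδ ρ' s hs
  have hsum : MeasureTheory.Integrable fun m => ∑ ρ, (pairR a (P.u ρ) : ℂ) *
      expProd P.u b z (Function.update g ρ (deriv (g ρ))) m :=
    MeasureTheory.integrable_finsetSum _ fun ρ _ => (hint' ρ).const_mul _
  have key := integral_bilinear_hasLineDerivAt_right_eq_neg_left_of_integrable
    (μ := MeasureTheory.volume) (B := ContinuousLinearMap.mul ℝ ℂ)
    (f := fun _ : Fin n → ℝ => (1 : ℂ)) (f' := fun _ => 0) (g := expProd P.u b z g)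
    (g' := fun m => pairC a z * expProd P.u b z g m + ∑ ρ, (pairR a (P.u ρ) : ℂ) *
        expProd P.u b z (Function.update g ρ (deriv (g ρ))) m) (v := a)
    (by simp) (((hint.const_mul (pairC a z)).add hsum).congr
      (Filter.Eventually.of_forall fun m => by simp)) (by simpa using hint)
    (fun x _ => hasDerivAt_const _ _)
    (fun x _ => hasLineDerivAt_expProd P.u b z
      (fun ρ => (hg ρ).differentiable one_ne_zero) a x)
  simp only [ContinuousLinearMap.mul_apply', one_mul, zero_mul, MeasureTheory.integral_zero,
    neg_zero] at key
  rw [MeasureTheory.integral_add (hint.const_mul _) hsum,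
    MeasureTheory.integral_finsetSum _ fun ρ _ => (hint' ρ).const_mul _,
    MeasureTheory.integral_const_mul] at key
  simp only [MeasureTheory.integral_const_mul] at key
  exact eq_neg_of_add_eq_zero_left key

/-! ### Smooth approximations of the step function -/

/-- For `δ > 0`, a smooth function that is `0` on `(-∞, -δ]` and `1` on `[0, ∞)`. -/
def softStep (δ s : ℝ) : ℝ := Real.smoothTransition (1 + s / δ)

lemma contDiff_softStep (δ : ℝ) (k : ℕ∞) : ContDiff ℝ k (softStep δ) := by
  unfold softStep
  exact Real.smoothTransition.contDiff.comp (by fun_prop)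

lemma contDiff_deriv_softStep (δ : ℝ) : ContDiff ℝ 1 (deriv (softStep δ)) :=
  ((contDiff_succ_iff_deriv (n := 1)).1 (contDiff_softStep δ 2)).2.2

lemma softStep_of_le {δ s : ℝ} (hδ : 0 < δ) (hs : s ≤ -δ) : softStep δ s = 0 := by
  refine Real.smoothTransition.zero_of_nonpos ?_
  have : s / δ ≤ -1 := by rwa [div_le_iff₀ hδ, neg_one_mul]
  linarith

lemma softStep_of_nonneg {δ s : ℝ} (hδ : 0 < δ) (hs : 0 ≤ s) : softStep δ s = 1 := by
  refine Real.smoothTransition.one_of_one_le ?_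
  have := div_nonneg hs hδ.le
  linarith

lemma softStep_nonneg (δ s : ℝ) : 0 ≤ softStep δ s := Real.smoothTransition.nonneg _

lemma softStep_le_one (δ s : ℝ) : softStep δ s ≤ 1 := Real.smoothTransition.le_one _

lemma deriv_smoothTransition_of_nonpos {x : ℝ} (hx : x ≤ 0) :
    deriv Real.smoothTransition x = 0 :=
  IsLocalMin.deriv_eq_zero (Filter.Eventually.of_forall fun y => by
    rw [Real.smoothTransition.zero_of_nonpos hx]
    exact Real.smoothTransition.nonneg y)

lemma deriv_smoothTransition_of_one_le {x : ℝ} (hx : 1 ≤ x) :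
    deriv Real.smoothTransition x = 0 :=
  IsLocalMax.deriv_eq_zero (Filter.Eventually.of_forall fun y => by
    rw [Real.smoothTransition.one_of_one_le hx]
    exact Real.smoothTransition.le_one y)

lemma deriv_softStep (δ s : ℝ) :
    deriv (softStep δ) s = deriv Real.smoothTransition (1 + s / δ) / δ := by
  have h1 : HasDerivAt (fun s : ℝ => 1 + s / δ) (1 / δ) s :=
    ((hasDerivAt_id s).div_const δ).const_add 1
  have h2 : DifferentiableAt ℝ Real.smoothTransition (1 + s / δ) :=
    (Real.smoothTransition.contDiff (n := 1)).differentiable one_ne_zero _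
  have h3 := (h2.hasDerivAt.comp s h1).deriv
  rw [mul_one_div] at h3
  exact h3

lemma deriv_softStep_of_le {δ s : ℝ} (hδ : 0 < δ) (hs : s ≤ -δ) : deriv (softStep δ) s = 0 := by
  rw [deriv_softStep, deriv_smoothTransition_of_nonpos, zero_div]
  have : s / δ ≤ -1 := by rwa [div_le_iff₀ hδ, neg_one_mul]
  linarith

lemma deriv_softStep_of_nonneg {δ s : ℝ} (hδ : 0 < δ) (hs : 0 ≤ s) :
    deriv (softStep δ) s = 0 := by
  rw [deriv_softStep, deriv_smoothTransition_of_one_le, zero_div]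
  have := div_nonneg hs hδ.le
  linarith

/-- The derivatives of the soft steps concentrate at `0` as `δ` tends to `0`. -/
lemma tendsto_integral_exp_mul_deriv_softStep (w : ℂ) :
    Filter.Tendsto (fun δ : ℝ => ∫ s : ℝ, Complex.exp (s * w) * ((deriv (softStep δ) s : ℝ) : ℂ))
      (nhdsWithin 0 (Set.Ioi 0)) (nhds 1) := by
  set T := deriv Real.smoothTransition with hT
  have hTc : Continuous T :=
    (Real.smoothTransition.contDiff (n := 1)).continuous_deriv le_rfl
  let Q : ℝ → ℝ → ℂ := fun δ x => Complex.exp ((δ * (x - 1) : ℝ) * w) * (T x : ℂ)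
  have hQ : Continuous (Function.uncurry Q) := by
    simp only [Q, Function.uncurry_def]
    fun_prop
  have hlim : Filter.Tendsto (fun δ => ∫ x in (0 : ℝ)..1, Q δ x) (nhds 0) (nhds 1) := by
    have h0 : ∫ x in (0 : ℝ)..1, Q 0 x = 1 := by
      simp only [Q, zero_mul, Complex.ofReal_zero, Complex.exp_zero, one_mul]
      rw [intervalIntegral.integral_ofReal, hT, intervalIntegral.integral_deriv_eq_sub]
      · simp
      · exact fun x _ =>
          (Real.smoothTransition.contDiff (n := 1)).differentiable one_ne_zero x
      · exact hTc.intervalIntegrable _ _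
    rw [← h0]
    exact (intervalIntegral.continuous_parametric_intervalIntegral_of_continuous'
      hQ 0 1).tendsto 0
  refine (hlim.mono_left nhdsWithin_le_nhds).congr' ?_
  filter_upwards [self_mem_nhdsWithin] with δ hδ
  have hδ' : (0 : ℝ) < δ := hδ
  have e1 : ∫ x in (0 : ℝ)..1, Q δ x = ∫ x, Q δ x := by
    refine intervalIntegral.integral_eq_integral_of_support_subset fun x hx => ?_
    by_contra hx'
    refine hx ?_
    have : T x = 0 := by
      rcases le_or_gt x 0 with h | h
      · exact deriv_smoothTransition_of_nonpos h
      · exact deriv_smoothTransition_of_one_le (le_of_not_ge fun h1 => hx' ⟨h, h1⟩)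
    simp [Q, this]
  rw [e1, ← MeasureTheory.integral_add_left_eq_self (Q δ) 1]
  have e2 := MeasureTheory.Measure.integral_comp_div (fun y => Q δ (1 + y)) δ
  rw [abs_of_pos hδ'] at e2
  have e3 : ∫ x, Q δ (1 + x) = (δ⁻¹ : ℝ) • ∫ x, Q δ (1 + x / δ) := by
    rw [e2, inv_smul_smul₀ hδ'.ne']
  rw [e3, ← MeasureTheory.integral_smul]
  refine MeasureTheory.integral_congr_ae (Filter.Eventually.of_forall fun s => ?_)
  have e4 : δ * (1 + s / δ - 1) = s := by field_simp; ring
  simp only [Q, e4, deriv_softStep, Complex.real_smul]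
  push_cast
  rw [div_eq_mul_inv]
  ring

/-! ### Smoothed face integrals and their recursion -/

open Classical in
/-- The derivative of the soft step for the inequalities in `τ`, and the soft step itself for the
others. -/
def faceProfile (δ : ℝ) (τ : Finset ι) (ρ : ι) : ℝ → ℝ :=
  if ρ ∈ τ then deriv (softStep δ) else softStep δ

lemma faceProfile_of_mem {κ : Type*} {δ : ℝ} {τ : Finset κ} {ρ : κ} (h : ρ ∈ τ) :
    faceProfile δ τ ρ = deriv (softStep δ) := if_pos h

lemma faceProfile_of_notMem {κ : Type*} {δ : ℝ} {τ : Finset κ} {ρ : κ} (h : ρ ∉ τ) :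
    faceProfile δ τ ρ = softStep δ := if_neg h

lemma contDiff_faceProfile {κ : Type*} (δ : ℝ) (τ : Finset κ) (ρ : κ) :
    ContDiff ℝ 1 (faceProfile δ τ ρ) := by
  by_cases h : ρ ∈ τ
  · rw [faceProfile_of_mem h]
    exact contDiff_deriv_softStep δ
  · rw [faceProfile_of_notMem h]
    exact contDiff_softStep δ 1

lemma faceProfile_of_lt {κ : Type*} {δ : ℝ} (hδ : 0 < δ) (τ : Finset κ) (ρ : κ) {s : ℝ}
    (hs : s < -δ) : faceProfile δ τ ρ s = 0 := by
  by_cases h : ρ ∈ τ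
  · rw [faceProfile_of_mem h, deriv_softStep_of_le hδ hs.le]
  · rw [faceProfile_of_notMem h, softStep_of_le hδ hs.le]

/-- A smooth substitute for the integral of `e^{⟨m, z⟩}` over the face
`{m | ⟨m, u_ρ⟩ + b_ρ = 0 for ρ ∈ τ}` of the polyhedron `{m | ⟨m, u_ρ⟩ + b_ρ ≥ 0}`: the indicator
functions of the half-spaces are replaced by soft steps, and the delta functions of the hyperplanes
with `ρ ∈ τ` by the derivatives of soft steps. -/
def faceIntegral (P : SimpleLatticePolytope n ι) (b : ι → ℝ) (z : Fin n → ℂ) (δ : ℝ)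
    (τ : Finset ι) : ℂ :=
  ∫ m, expProd P.u b z (faceProfile δ τ) m

/-- The right-hand sides `b` for which, up to an error `δ`, the polyhedron
`{m | ⟨m, u_ρ⟩ + b_ρ ≥ 0}` has the combinatorial type of `P`. -/
structure HasTypeOf (P : SimpleLatticePolytope n ι) (b : ι → ℝ) (δ : ℝ) : Prop where
  exists_cone : ∀ m : Fin n → ℝ, (∀ ρ, -δ ≤ pairR m (P.u ρ) + b ρ) →
    ∃ σ : P.MaxCone, ∀ ρ, pairR m (P.u ρ) + b ρ ≤ 0 → ρ ∈ σ.rays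
  nonneg_off_cone : ∀ (σ : P.MaxCone) (m : Fin n → ℝ),
    (∀ ρ ∈ σ.rays, -δ ≤ pairR m (P.u ρ) + b ρ ∧ pairR m (P.u ρ) + b ρ ≤ 0) →
      ∀ ρ, ρ ∉ σ.rays → 0 ≤ pairR m (P.u ρ) + b ρ

lemma exists_hasTypeOf_dilation (P : SimpleLatticePolytope n ι) :
    ∃ ε : ℝ, 0 < ε ∧ ∀ h : ι → ℝ, (∀ ρ, |h ρ| < ε) → ∀ δ : ℝ, δ < ε →
      HasTypeOf P (fun ρ => P.c ρ + h ρ) δ := by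
  obtain ⟨ε₁, hε₁, h₁⟩ := exists_maxCone_of_nearly_active P
  obtain ⟨ε₂, hε₂, h₂⟩ := exists_gap P
  refine ⟨min ε₁ ε₂ / 2, half_pos (lt_min hε₁ hε₂), fun h hh δ hδ => ⟨fun m hm => ?_,
    fun σ m hm ρ hρ => ?_⟩⟩
  · have hle := min_le_left ε₁ ε₂
    obtain ⟨σ, hσ⟩ := h₁ m fun ρ => by linarith [hm ρ, (abs_lt.1 (hh ρ)).2]
    exact ⟨σ, fun ρ hρ => hσ ρ (by linarith [(abs_lt.1 (hh ρ)).1])⟩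
  · have hle := min_le_right ε₁ ε₂
    have := h₂ σ m (fun ρ' hρ' => abs_le.2
      ⟨by linarith [(hm ρ' hρ').1, (abs_lt.1 (hh ρ')).2],
        by linarith [(hm ρ' hρ').2, (abs_lt.1 (hh ρ')).1]⟩) ρ hρ
    linarith [(abs_lt.1 (hh ρ)).1]

lemma neg_le_of_expProd_faceProfile_ne_zero {b : ι → ℝ} {z : Fin n → ℂ} {δ : ℝ} (hδ : 0 < δ)
    {τ : Finset ι} {m : Fin n → ℝ} (hm : expProd P.u b z (faceProfile δ τ) m ≠ 0) (ρ : ι) :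
    -δ ≤ pairR m (P.u ρ) + b ρ := by
  have := mem_polyhedron_of_expProd_ne_zero
    (fun ρ s hs => faceProfile_of_lt hδ τ ρ hs) hm ρ
  linarith

lemma nonpos_of_expProd_faceProfile_ne_zero {b : ι → ℝ} {z : Fin n → ℂ} {δ : ℝ} (hδ : 0 < δ)
    {τ : Finset ι} {m : Fin n → ℝ} (hm : expProd P.u b z (faceProfile δ τ) m ≠ 0) {ρ : ι}
    (hρ : ρ ∈ τ) : pairR m (P.u ρ) + b ρ ≤ 0 := by
  by_contra hneg
  refine hm (mul_eq_zero_of_right _ (Finset.prod_eq_zero (Finset.mem_univ ρ) ?_))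
  rw [faceProfile_of_mem hρ, deriv_softStep_of_nonneg hδ (not_le.1 hneg).le, Complex.ofReal_zero]

/-- Facets without a common vertex contribute nothing. -/
lemma faceIntegral_eq_zero {b : ι → ℝ} {δ : ℝ} (hδ : 0 < δ) (hb : HasTypeOf P b δ)
    (z : Fin n → ℂ) {τ : Finset ι} (hτ : ∀ σ : P.MaxCone, ¬ τ ⊆ σ.rays) :
    faceIntegral P b z δ τ = 0 := by
  have : ∀ m, expProd P.u b z (faceProfile δ τ) m = 0 := by
    intro m
    by_contra hm
    obtain ⟨σ, hσ⟩ := hb.exists_cone m (neg_le_of_expProd_faceProfile_ne_zero hδ hm)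
    exact hτ σ fun ρ hρ => hσ ρ (nonpos_of_expProd_faceProfile_ne_zero hδ hm hρ)
  simp [faceIntegral, this]

/-- Stokes' theorem on a face: a direction tangent to all facets in `τ` expresses the integral over
the face `τ` by integrals over the faces with one more facet. -/
lemma pairC_mul_faceIntegral [DecidableEq ι] (b : ι → ℝ) (z : Fin n → ℂ) {δ : ℝ} (hδ : 0 < δ)
    (τ : Finset ι) {a : Fin n → ℝ} (ha : ∀ ρ ∈ τ, pairR a (P.u ρ) = 0) :
    pairC a z * faceIntegral P b z δ τ =
      -∑ ρ, (pairR a (P.u ρ) : ℂ) * faceIntegral P b z δ (insert ρ τ) := by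
  rw [faceIntegral, pairC_mul_integral_expProd P b z (contDiff_faceProfile δ τ)
    (fun ρ s hs => faceProfile_of_lt hδ τ ρ hs) a]
  congr 1
  refine Finset.sum_congr rfl fun ρ _ => ?_
  by_cases hρ : ρ ∈ τ
  · rw [ha ρ hρ, Complex.ofReal_zero, zero_mul, zero_mul]
  congr 1
  suffices e : Function.update (faceProfile δ τ) ρ (deriv (faceProfile δ τ ρ)) =
      faceProfile δ (insert ρ τ) by rw [e, faceIntegral]
  funext ρ'
  rcases eq_or_ne ρ' ρ with rfl | hne
  · rw [Function.update_self, faceProfile_of_notMem hρ,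
      faceProfile_of_mem (Finset.mem_insert_self _ _)]
  · rw [Function.update_of_ne hne]
    by_cases h' : ρ' ∈ τ
    · rw [faceProfile_of_mem h', faceProfile_of_mem (Finset.mem_insert_of_mem h')]
    · rw [faceProfile_of_notMem h', faceProfile_of_notMem]
      simp [hne, h']

open Classical in
/-- The integral over a face is a sum of contributions of its vertices. -/
lemma faceIntegral_eq_sum {b : ι → ℝ} {z : Fin n → ℂ} {δ : ℝ} (hδ : 0 < δ)
    (hb : HasTypeOf P b δ)
    (hz : ∀ σ : P.MaxCone, ∀ ρ ∈ σ.rays, pairC (dualVec σ ρ) z ≠ 0) (τ : Finset ι) :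
    faceIntegral P b z δ τ = ∑ σ : P.MaxCone with τ ⊆ σ.rays,
      faceIntegral P b z δ σ.rays / ∏ ρ ∈ σ.rays \ τ, (-pairC (dualVec σ ρ) z) := by
  induction hk : Fintype.card ι - τ.card using Nat.strong_induction_on generalizing τ with
  | _ k ih =>
  by_cases hτ : ∀ σ : P.MaxCone, ¬ τ ⊆ σ.rays
  · rw [faceIntegral_eq_zero hδ hb z hτ, Finset.filter_false_of_mem fun σ _ => hτ σ,
      Finset.sum_empty]
  push Not at hτ
  obtain ⟨σ₀, hσ₀⟩ := hτ
  rcases hσ₀.eq_or_ssubset with rfl | hss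
  · have : ({σ : P.MaxCone | σ₀.rays ⊆ σ.rays} : Finset P.MaxCone) = {σ₀} := by
      ext σ
      rw [Finset.mem_filter_univ, Finset.mem_singleton]
      refine ⟨fun h => ?_, fun h => h ▸ subset_rfl⟩
      exact Subtype.ext (Finset.eq_of_subset_of_card_le h
        ((card_rays σ).trans (card_rays σ₀).symm).le).symm
    rw [this, Finset.sum_singleton, Finset.sdiff_self, Finset.prod_empty, div_one]
  obtain ⟨ρ₀, hρ₀, hρ₀τ⟩ := Finset.exists_of_ssubset hss
  -- The edge direction at the vertex `σ₀` that leaves only the facet `ρ₀` is tangent to `τ`.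
  set a := dualVec σ₀ ρ₀ with ha
  have haτ : ∀ ρ ∈ τ, pairR a (P.u ρ) = 0 := fun ρ hρ =>
    pairR_dualVec_of_ne (hσ₀ hρ) fun e => hρ₀τ (e ▸ hρ)
  refine mul_left_cancel₀ (hz σ₀ ρ₀ hρ₀) ?_
  rw [pairC_mul_faceIntegral b z hδ τ haτ, Finset.mul_sum, ← Finset.sum_neg_distrib]
  have hstep : ∀ ρ, -((pairR a (P.u ρ) : ℂ) * faceIntegral P b z δ (insert ρ τ)) =
      ∑ σ : P.MaxCone with τ ⊆ σ.rays, (pairR a (P.u ρ) : ℂ) * pairC (dualVec σ ρ) z *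
        (faceIntegral P b z δ σ.rays / ∏ ρ ∈ σ.rays \ τ, (-pairC (dualVec σ ρ) z)) := by
    intro ρ
    by_cases hρ : ρ ∈ τ
    · simp [haτ ρ hρ]
    have hlt : Fintype.card ι - (insert ρ τ).card < k := by
      have h1 := Finset.card_le_univ (insert ρ τ)
      rw [Finset.card_insert_of_notMem hρ] at h1 ⊢
      omega
    have hsub : ({σ : P.MaxCone | insert ρ τ ⊆ σ.rays} : Finset P.MaxCone) ⊆
        ({σ : P.MaxCone | τ ⊆ σ.rays} : Finset P.MaxCone) := fun σ => by
      simp only [Finset.mem_filter_univ]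
      exact fun h => (Finset.subset_insert ρ τ).trans h
    rw [ih _ hlt (insert ρ τ) rfl, Finset.mul_sum, ← Finset.sum_neg_distrib]
    refine Finset.sum_subset_zero_on_sdiff hsub (fun σ hσ => ?_) fun σ hσ => ?_
    · have hρσ : ρ ∉ σ.rays := by
        simp only [Finset.mem_sdiff, Finset.mem_filter_univ] at hσ
        exact fun h => hσ.2 (Finset.insert_subset h hσ.1)
      rw [dualVec_of_notMem hρσ]
      simp [pairC]
    · have hins : insert ρ τ ⊆ σ.rays := by simpa using hσ
      have hρσ : ρ ∈ σ.rays := hins (Finset.mem_insert_self _ _)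
      have hw := hz σ ρ hρσ
      have herase : σ.rays \ insert ρ τ = (σ.rays \ τ).erase ρ := by
        ext x
        simp only [Finset.mem_sdiff, Finset.mem_insert, Finset.mem_erase]
        tauto
      rw [herase, ← Finset.mul_prod_erase (σ.rays \ τ) _ (Finset.mem_sdiff.2 ⟨hρσ, hρ⟩)]
      have hne : ∏ x ∈ (σ.rays \ τ).erase ρ, (-pairC (dualVec σ x) z) ≠ 0 :=
        Finset.prod_ne_zero_iff.2 fun x hx => neg_ne_zero.2
          (hz σ x (Finset.mem_sdiff.1 (Finset.mem_of_mem_erase hx)).1)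
      field_simp
  rw [Finset.sum_congr rfl fun ρ _ => hstep ρ, Finset.sum_comm]
  refine Finset.sum_congr rfl fun σ _ => ?_
  rw [← Finset.sum_mul]
  congr 1
  rw [pairC_eq_sum_dualVec σ a z]
  refine (Finset.sum_subset (Finset.subset_univ _) fun ρ _ hρ => ?_).symm
  rw [dualVec_of_notMem hρ]
  simp [pairC]

/-! ### The contributions of the vertices -/

lemma integral_comp_mulVec_add (A : Matrix (Fin n) (Fin n) ℝ) (hA : A.det ≠ 0)
    {f : (Fin n → ℝ) → ℂ} (hf : Continuous f) (b : Fin n → ℝ) :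
    ∫ x, f (A.mulVec x + b) = (|A.det|⁻¹ : ℝ) * ∫ x, f x := by
  have hm : Measurable (Matrix.toLin' A) :=
    (LinearMap.continuous_of_finiteDimensional _).measurable
  have h := MeasureTheory.integral_map (μ := MeasureTheory.volume) hm.aemeasurable
    (f := fun y => f (y + b)) (by
      exact (hf.comp (continuous_add_const b)).aestronglyMeasurable)
  rw [Real.map_matrix_volume_pi_eq_smul_volume_pi hA, MeasureTheory.integral_smul_measure,
    ENNReal.toReal_ofReal (abs_nonneg _), abs_inv,
    MeasureTheory.integral_add_right_eq_self (μ := MeasureTheory.volume) f b] at h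
  rw [← Complex.real_smul, h]
  rfl

/-- At a vertex the integrand is a product in the coordinates dual to the edges. -/
lemma expProd_faceProfile_rays {h : ι → ℝ} {δ : ℝ} (hδ : 0 < δ)
    (hb : HasTypeOf P (fun ρ => P.c ρ + h ρ) δ) (z : Fin n → ℂ) (σ : P.MaxCone)
    (m : Fin n → ℝ) :
    expProd P.u (fun ρ => P.c ρ + h ρ) z (faceProfile δ σ.rays) m =
      Complex.exp (pairC (dilationVertex σ h) z) * ∏ ρ ∈ σ.rays,
        (Complex.exp ((pairR m (P.u ρ) + (P.c ρ + h ρ) : ℝ) * pairC (dualVec σ ρ) z) *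
          (deriv (softStep δ) (pairR m (P.u ρ) + (P.c ρ + h ρ)) : ℝ)) := by
  classical
  have hm : pairC m z = pairC (dilationVertex σ h) z + ∑ ρ ∈ σ.rays,
      ((pairR m (P.u ρ) + (P.c ρ + h ρ) : ℝ) : ℂ) * pairC (dualVec σ ρ) z := by
    rw [← pairC_sum_smul, ← pairC_add]
    congr 1
    refine ext_of_pairR σ fun ρ hρ => ?_
    rw [pairR_add, pairR_sum_dualVec (fun ρ => pairR m (P.u ρ) + (P.c ρ + h ρ)) hρ]
    linarith [pairR_dilationVertex h hρ]
  rw [Finset.prod_mul_distrib, ← Complex.exp_sum, ← mul_assoc, ← Complex.exp_add, ← hm, expProd]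
  congr 1
  by_cases hin : ∀ ρ ∈ σ.rays, -δ ≤ pairR m (P.u ρ) + (P.c ρ + h ρ) ∧
      pairR m (P.u ρ) + (P.c ρ + h ρ) ≤ 0
  · symm
    refine Finset.prod_subset_one_on_sdiff (Finset.subset_univ _) (fun ρ hρ => ?_) fun ρ hρ => ?_
    · have hρ' := (Finset.mem_sdiff.1 hρ).2
      rw [faceProfile_of_notMem hρ',
        softStep_of_nonneg hδ (hb.nonneg_off_cone σ m hin ρ hρ'), Complex.ofReal_one]
    · rw [faceProfile_of_mem hρ]
  · -- Both products contain the same vanishing factor.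
    push Not at hin
    obtain ⟨ρ, hρ, hlt⟩ := hin
    have h0 : deriv (softStep δ) (pairR m (P.u ρ) + (P.c ρ + h ρ)) = 0 := by
      rcases le_or_gt (-δ) (pairR m (P.u ρ) + (P.c ρ + h ρ)) with hle | hgt
      · exact deriv_softStep_of_nonneg hδ (hlt hle).le
      · exact deriv_softStep_of_le hδ hgt.le
    rw [Finset.prod_eq_zero (Finset.mem_univ ρ) (by
      rw [faceProfile_of_mem hρ, h0, Complex.ofReal_zero]),
      Finset.prod_eq_zero hρ (by rw [h0, Complex.ofReal_zero])]

lemma faceIntegral_rays {h : ι → ℝ} {δ : ℝ} (hδ : 0 < δ)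
    (hb : HasTypeOf P (fun ρ => P.c ρ + h ρ) δ) (z : Fin n → ℂ) (σ : P.MaxCone) :
    faceIntegral P (fun ρ => P.c ρ + h ρ) z δ σ.rays =
      (|(realRayMatrix σ).det|⁻¹ : ℝ) * (Complex.exp (pairC (dilationVertex σ h) z) *
        ∏ ρ ∈ σ.rays, ∫ s : ℝ, Complex.exp (s * pairC (dualVec σ ρ) z) *
          (deriv (softStep δ) s : ℝ)) := by
  let f : (Fin n → ℝ) → ℂ := fun s => ∏ i, (Complex.exp (s i *
    pairC (dualVec σ (rayEquiv σ i)) z) * (deriv (softStep δ) (s i) : ℝ))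
  have hf : Continuous f := by
    have := (contDiff_deriv_softStep δ).continuous
    fun_prop
  have hprod : ∀ g : ι → ℂ, ∏ ρ ∈ σ.rays, g ρ = ∏ i, g (rayEquiv σ i) := fun g => by
    rw [← Finset.prod_coe_sort, ← (rayEquiv σ).prod_comp]
  simp only [faceIntegral, expProd_faceProfile_rays hδ hb]
  rw [MeasureTheory.integral_const_mul, mul_left_comm]
  congr 1
  have e1 : ∀ m : Fin n → ℝ, ∏ ρ ∈ σ.rays,
        (Complex.exp ((pairR m (P.u ρ) + (P.c ρ + h ρ) : ℝ) * pairC (dualVec σ ρ) z) *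
          (deriv (softStep δ) (pairR m (P.u ρ) + (P.c ρ + h ρ)) : ℝ)) =
      f ((realRayMatrix σ).mulVec m + fun i => P.c (rayEquiv σ i) + h (rayEquiv σ i)) := by
    intro m
    rw [hprod]
    simp only [f, Pi.add_apply, realRayMatrix_mulVec]
  simp only [e1]
  rw [integral_comp_mulVec_add _ (det_realRayMatrix_ne_zero σ) hf, hprod]
  congr 1
  exact MeasureTheory.integral_fintype_prod_volume_eq_prod fun i (s : ℝ) =>
    Complex.exp (s * pairC (dualVec σ (rayEquiv σ i)) z) * (deriv (softStep δ) s : ℝ)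

/-! ### The limit of sharp steps -/

lemma measurableSet_dilation (P : SimpleLatticePolytope n ι) (h : ι → ℝ) :
    MeasurableSet (P.dilation h) :=
  (isClosed_polyhedron _ _).measurableSet

lemma integrableOn_exp_dilation (P : SimpleLatticePolytope n ι) (h : ι → ℝ) (z : Fin n → ℂ) :
    MeasureTheory.IntegrableOn (fun m : Fin n → ℝ => Complex.exp (pairC m z)) (P.dilation h)
      MeasureTheory.volume :=
  (Complex.continuous_exp.comp (continuous_pairC z)).continuousOn.integrableOn_compact
    (isCompact_polyhedron P _)

/-- The smoothed integral over the whole polytope tends to the integral over `P(h)`. -/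
lemma tendsto_faceIntegral_empty (P : SimpleLatticePolytope n ι) (h : ι → ℝ) (z : Fin n → ℂ) :
    Filter.Tendsto (fun δ => faceIntegral P (fun ρ => P.c ρ + h ρ) z δ ∅)
      (nhdsWithin 0 (Set.Ioi 0)) (nhds (∫ m in P.dilation h, Complex.exp (pairC m z))) := by
  rw [← MeasureTheory.integral_indicator (measurableSet_dilation P h)]
  set K := polyhedron P.u fun ρ => (P.c ρ + h ρ) + 1 with hK
  have hKc : IsCompact K := isCompact_polyhedron P _
  have hpos : ∀ᶠ δ in nhdsWithin (0 : ℝ) (Set.Ioi 0), (0 : ℝ) < δ := eventually_mem_nhdsWithin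
  have hsmall : ∀ r : ℝ, 0 < r → ∀ᶠ δ in nhdsWithin (0 : ℝ) (Set.Ioi 0), δ < r := fun r hr =>
    Filter.Eventually.filter_mono nhdsWithin_le_nhds (gt_mem_nhds hr)
  refine MeasureTheory.tendsto_integral_filter_of_dominated_convergence
    (K.indicator fun m => ‖Complex.exp (pairC m z)‖) ?_ ?_ ?_ ?_
  · exact Filter.Eventually.of_forall fun δ => (continuous_expProd P.u _ z fun ρ =>
      (contDiff_faceProfile δ ∅ ρ).continuous).aestronglyMeasurable
  · filter_upwards [hpos, hsmall 1 one_pos] with δ hδ hδ1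
    refine Filter.Eventually.of_forall fun m => ?_
    by_cases hm : expProd P.u (fun ρ => P.c ρ + h ρ) z (faceProfile δ ∅) m = 0
    · rw [hm, norm_zero]
      exact Set.indicator_nonneg (fun _ _ => norm_nonneg _) _
    · have hmK : m ∈ K := fun ρ => by
        have := neg_le_of_expProd_faceProfile_ne_zero hδ hm ρ
        linarith
      rw [Set.indicator_of_mem hmK, expProd, norm_mul, norm_prod]
      refine mul_le_of_le_one_right (norm_nonneg _) (Finset.prod_le_one
        (fun _ _ => norm_nonneg _) fun ρ _ => ?_)
      rw [faceProfile_of_notMem (Finset.notMem_empty ρ), Complex.norm_real,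
        Real.norm_of_nonneg (softStep_nonneg _ _)]
      exact softStep_le_one _ _
  · refine MeasureTheory.IntegrableOn.integrable_indicator ?_ hKc.measurableSet
    exact ((Complex.continuous_exp.comp
      (continuous_pairC z)).norm).continuousOn.integrableOn_compact hKc
  · refine Filter.Eventually.of_forall fun m => tendsto_const_nhds.congr' ?_
    by_cases hm : m ∈ P.dilation h
    · filter_upwards [hpos] with δ hδ
      rw [Set.indicator_of_mem hm, expProd, Finset.prod_eq_one, mul_one]
      intro ρ _
      rw [faceProfile_of_notMem (Finset.notMem_empty ρ), softStep_of_nonneg hδ (hm ρ),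
        Complex.ofReal_one]
    · rw [Set.indicator_of_notMem hm]
      obtain ⟨ρ, hρ⟩ := not_forall.1 hm
      rw [not_le] at hρ
      filter_upwards [hpos, hsmall _ (neg_pos.2 hρ)] with δ hδ hδm
      symm
      refine mul_eq_zero_of_right _ (Finset.prod_eq_zero (Finset.mem_univ ρ) ?_)
      rw [faceProfile_of_notMem (Finset.notMem_empty ρ), softStep_of_le hδ (by linarith),
        Complex.ofReal_zero]

lemma tendsto_faceIntegral_rays {h : ι → ℝ} {ε : ℝ} (hε : 0 < ε)
    (hb : ∀ δ < ε, HasTypeOf P (fun ρ => P.c ρ + h ρ) δ) (z : Fin n → ℂ) (σ : P.MaxCone) :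
    Filter.Tendsto (fun δ => faceIntegral P (fun ρ => P.c ρ + h ρ) z δ σ.rays)
      (nhdsWithin 0 (Set.Ioi 0))
      (nhds ((|(realRayMatrix σ).det|⁻¹ : ℝ) *
        Complex.exp (pairC (dilationVertex σ h) z))) := by
  have hlim := ((tendsto_finsetProd σ.rays fun ρ _ =>
    tendsto_integral_exp_mul_deriv_softStep (pairC (dualVec σ ρ) z)).const_mul
      (Complex.exp (pairC (dilationVertex σ h) z))).const_mul
        ((|(realRayMatrix σ).det|⁻¹ : ℝ) : ℂ)
  rw [Finset.prod_const_one, mul_one] at hlim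
  refine hlim.congr' ?_
  filter_upwards [eventually_mem_nhdsWithin,
    Filter.Eventually.filter_mono nhdsWithin_le_nhds (gt_mem_nhds hε)] with δ hδ hδε
  exact (faceIntegral_rays hδ (hb δ hδε) z σ).symm

/-- Brion's formula for `P(h)`, in terms of vertices and edge directions. -/
lemma integral_exp_dilation {h : ι → ℝ} {ε : ℝ} (hε : 0 < ε)
    (hb : ∀ δ < ε, HasTypeOf P (fun ρ => P.c ρ + h ρ) δ) {z : Fin n → ℂ}
    (hz : ∀ σ : P.MaxCone, ∀ ρ ∈ σ.rays, pairC (dualVec σ ρ) z ≠ 0) :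
    ∫ m in P.dilation h, Complex.exp (pairC m z) =
      ∑ σ : P.MaxCone, (|(realRayMatrix σ).det|⁻¹ : ℝ) *
        Complex.exp (pairC (dilationVertex σ h) z) /
          ∏ ρ ∈ σ.rays, (-pairC (dualVec σ ρ) z) := by
  classical
  refine tendsto_nhds_unique (tendsto_faceIntegral_empty P h z) ?_
  refine (tendsto_finsetSum Finset.univ fun σ _ =>
    (tendsto_faceIntegral_rays hε hb z σ).div_const _).congr' ?_
  filter_upwards [eventually_mem_nhdsWithin,
    Filter.Eventually.filter_mono nhdsWithin_le_nhds (gt_mem_nhds hε)] with δ hδ hδε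
  rw [faceIntegral_eq_sum hδ (hb δ hδε) hz ∅]
  simp

end Toric
end

open Toric in
theorem theorem5p1 {n : ℕ} {ι : Type*} [Fintype ι] (P : SimpleLatticePolytope n ι) :
    ∃ ε : ℝ, 0 < ε ∧ ∀ h : ι → ℝ, (∀ ρ, |h ρ| < ε) →
      ∀ z : Fin n → ℂ,
        (∀ σ : P.MaxCone, ∀ ρ ∈ σ.rays, evalAt z (pullback σ (F P ρ)) ≠ 0) →
        MeasureTheory.IntegrableOn (fun m : Fin n → ℝ => Complex.exp (pairC m z))
            (P.dilation h) MeasureTheory.volume ∧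
        ∫ m in P.dilation h, Complex.exp (pairC m z) =
          ∑ σ : P.MaxCone, Complex.exp (evalAt z (pullback σ (dilationClass P h))) /
            evalAt z (eulerClass σ) ∧
        (∀ σ : P.MaxCone, evalAt z (pullback σ (dilationClass P h)) =
          evalAt z (pullback σ (chernClassPolytope P)) +
            ∑ ρ, (h ρ : ℂ) * evalAt z (pullback σ (F P ρ))) ∧
        ∑ σ : P.MaxCone, Complex.exp (evalAt z (pullback σ (dilationClass P h))) /
            evalAt z (eulerClass σ) =
          ∑ σ : P.MaxCone, Complex.exp (evalAt z (pullback σ (chernClassPolytope P))) /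
            evalAt z (eulerClass σ) *
            Complex.exp (∑ ρ, (h ρ : ℂ) * evalAt z (pullback σ (F P ρ))) := by
  obtain ⟨ε, hε, hP⟩ := exists_hasTypeOf_dilation P
  refine ⟨ε, hε, fun h hh z hz => ⟨integrableOn_exp_dilation P h z, ?_,
    fun σ => evalAt_dilationClass_eq_add σ h z, Finset.sum_congr rfl fun σ _ => ?_⟩⟩
  · have hz' : ∀ σ : P.MaxCone, ∀ ρ ∈ σ.rays, pairC (dualVec σ ρ) z ≠ 0 := fun σ ρ hρ => by
      have := hz σ ρ hρ
      rwa [evalAt_F, neg_ne_zero] at this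
    rw [integral_exp_dilation hε (hP h hh) hz']
    refine Finset.sum_congr rfl fun σ _ => ?_
    rw [evalAt_dilationClass, evalAt_eulerClass, Complex.ofReal_inv, inv_mul_eq_div, div_div]
  · rw [evalAt_dilationClass_eq_add, Complex.exp_add, div_mul_eq_mul_div]
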